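/- All graphs are finite and simple, and $\mathbb{N}=\{0,1,2,\dots\}$. We use the following notions for a graph $G$. A \emph{depth-$\ell$ minor} of $G$ is a graph obtained from a subgraph of $G$ by contracting pairwise vertex-disjoint subgraphs, each of radius at most $\ell$. Let $\nabla_\ell(G)$ be the maximum of $|E(H)|/|V(H)|$ over all depth-$\ell$ minors $H$ of $G$ (with the convention $0/0=0$). The \emph{expansion of $G$ is bounded by} $f:\mathbb{N}\to\mathbb{N}$ if $\nabla_\ell(G)\le f(\ell)$ for every integer $\ell\ge 0$. For a linear ordering $\prec$ of $V(G)$, a vertex $v$ and an integer $r\ge 0$, let $L^\prec_r(v)$ be the set of vertices $u$ for which $G$ has a path $P$ from $v$ to $u$ of length at most $r$ with $u\preceq x$ for every $x\in V(P)$. The \emph{weak $r$-coloring number} is $\mathrm{wcol}_r(G)=\min_{\prec}\max_{v\in V(G)}|L^\prec_r(v)|$ (the maximum being $0$ if $V(G)=\emptyset$). A set $C\subseteq V(G)$ is a \emph{balanced separator} in $G$ if each component of $G-C$ has at most $\tfrac23|V(G)|$ vertices. For $\rho:V(G)\to[0,\infty)$ and $X\subseteq V(G)$, let $\rho(X)=\sum_{x\in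 X}\rho(x)$. For an integer $t\ge1$ and a real number $s$, the set $C$ is \emph{$(\rho/t)$-cheap with at most $s$ outliers} if there is $C'\subseteq C$ with $|C'|\le s$ and $\rho(C\setminus C')\le\rho(V(G))/t$. Let $\log^{(0)}x=x$ and $\log^{(i+1)}x=\log_2\max\bigl(2,\log^{(i)}x\bigr)$ for $i\ge0$. \textbf{Theorem.} For every polynomial $p:\mathbb{N}\to\mathbb{N}$ and every integer $a\ge0$, there exists a polynomial $q:\mathbb{N}\to\mathbb{N}$ such that the following holds. Let $G$ be an $n$-vertex graph with expansion bounded by $p$ and let $\rho:V(G)\to[0,\infty)$. For every integer $t\ge1$, $G$ has a balanced separator that is $(\rho/t)$-cheap with at most $$q(t)\cdot\bigl(\mathrm{wcol}_{q(t)}(G)\bigr)^5\cdot\log^{(a)}n$$ outliers. -/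

import Mathlib

open scoped ENNReal

/-- `f : ℕ → ℕ` is (the restriction to `ℕ` of) a polynomial. -/
def IsPolynomialFun (f : ℕ → ℕ) : Prop :=
  ∃ P : Polynomial ℝ, ∀ k : ℕ, (f k : ℝ) = P.eval (k : ℝ)

/-- The iterated logarithm: `log^(0) x = x`, `log^(i+1) x = log₂ (max 2 (log^(i) x))`. -/
noncomputable def iterLog : ℕ → ℝ → ℝ
  | 0, x => x
  | i + 1, x => Real.logb 2 (max 2 (iterLog i x))

namespace SimpleGraph

/-- `H` is a depth-`l` minor of `G`: there are pairwise vertex-disjoint subgraphs of `G`, one for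
each vertex of `H`, each of radius at most `l` (so nonempty and connected), such that `G` has an
edge between the subgraphs of any two adjacent vertices of `H`.  Vertices and edges of `G` not used
here are removed when passing to a subgraph of `G` before contracting. -/
def IsDepthMinor {W V : Type*} (l : ℕ) (H : SimpleGraph W) (G : SimpleGraph V) : Prop :=
  ∃ bag : W → G.Subgraph,
    (∀ w, (bag w).coe.radius ≤ (l : ℕ∞)) ∧
    (∀ w w', w ≠ w' → Disjoint (bag w).verts (bag w').verts) ∧
    (∀ w w', H.Adj w w' → ∃ x ∈ (bag w).verts, ∃ y ∈ (bag w').verts, G.Adj x y)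

/-- The density `|E(H)| / |V(H)|` of a finite graph. -/
noncomputable def density {W : Type*} (H : SimpleGraph W) : ℝ≥0∞ :=
  (H.edgeSet.ncard : ℝ≥0∞) / (Nat.card W : ℝ≥0∞)

/-- `∇_l(G)`, the maximum density of a depth-`l` minor of the finite graph `G`.  Minors of `G` are
finite, so up to isomorphism their vertex sets are `Fin k`. -/
noncomputable def nabla {V : Type*} (l : ℕ) (G : SimpleGraph V) : ℝ≥0∞ :=
  ⨆ (k : ℕ) (H : SimpleGraph (Fin k)) (_ : IsDepthMinor l H G), H.density

/-- The expansion of `G` is bounded by `f`. -/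
def ExpansionBoundedBy {V : Type*} (G : SimpleGraph V) (f : ℕ → ℕ) : Prop :=
  ∀ l : ℕ, G.nabla l ≤ (f l : ℝ≥0∞)

/-- `L_r^≺(v)`, the set of vertices `(≺, r)`-reachable from `v`, for the linear order `o` on the
vertices. -/
def weakReach {V : Type*} (G : SimpleGraph V) (o : LinearOrder V) (r : ℕ) (v : V) : Set V :=
  {u | ∃ P : G.Walk v u, P.IsPath ∧ P.length ≤ r ∧ ∀ x ∈ P.support, o.le u x}

/-- `wcol_r^≺(G)`, the maximum of `|L_r^≺(v)|` over the vertices `v`. -/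
noncomputable def wcolOrder {V : Type*} [Fintype V] (G : SimpleGraph V) (o : LinearOrder V)
    (r : ℕ) : ℕ :=
  Finset.univ.sup fun v => (G.weakReach o r v).ncard

/-- The weak `r`-coloring number, the minimum of `wcol_r^≺(G)` over all linear orders. -/
noncomputable def wcol {V : Type*} [Fintype V] (G : SimpleGraph V) (r : ℕ) : ℕ :=
  ⨅ o : LinearOrder V, G.wcolOrder o r

/-- `C` is a balanced separator: each component of `G - C` has at most `2/3 |V(G)|` vertices. -/
def IsBalancedSeparator {V : Type*} [Fintype V] (G : SimpleGraph V) (C : Finset V) : Prop :=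
  ∀ K : (G.induce ((C : Set V)ᶜ)).ConnectedComponent,
    (K.supp.ncard : ℝ) ≤ 2 / 3 * (Fintype.card V : ℝ)

end SimpleGraph

/-- `C` is `(ρ/t)`-cheap with `q` outliers.  Here `q` is any real bound on the number of outliers;
this is the same as being so with `⌊q⌋` outliers if `q ≥ 0`. -/
def IsCheapWithOutliers {V : Type*} [Fintype V] [DecidableEq V] (ρ : V → ℝ) (t : ℕ) (q : ℝ)
    (C : Finset V) : Prop :=
  ∃ C' ⊆ C, (C'.card : ℝ) ≤ q ∧ ∑ x ∈ C \ C', ρ x ≤ (∑ x, ρ x) / (t : ℝ)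

/-!
The proof goes by induction on the number `a` of logarithms, a power of `log^(a) n` being allowed in
the bound (`HasPolylogOutliers`); for `a = 0` all vertices can be outliers.

For the induction step (`HasPolylogOutliers.succ`), let `C₀` be a separator with `N` outliers. The
set `S` of vertices of cost more than `ρ(V) / (4tN)` has at most `4tN` elements, and `C₀ \ S` is
cheap without any outliers.  So only the vertices near `S` matter: deleting the vertices at distance
exactly `i` from `S`, for some `i ≤ 4t`, is cheap, and what lies farther away is disjoint from `S`
and hence separated by `C₀ \ S` (`IsBalancedSeparator.exists_few_outliers`).  Fix a linear order
realizing the weak coloring number `c` of radius `4t`.  The vertices near `S` are covered by the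
clusters `T x = {u | x weakly reachable from u}`, where `x` runs through the at most `c |S|`
vertices weakly reachable from `S`.  Each cluster has radius at most `4t`, each vertex lies in at
most `c` of them, and a vertex near `S` remains covered after the deletion of a set of vertices `M`
by a cluster `T x` with `x ∉ M`, or else is no longer near `S`.

The touching clusters form a graph with only `c |S|` vertices, to which the argument of Plotkin, Rao
and Smith applies (`exists_cluster_separation`): pairwise touching bags of clusters are collected,
and balls around clusters of small radius either connect all bags, giving a new bag, or one of them
is surrounded by a cheap layer.  Since a vertex lies in clusters of at most two consecutive layers,
the cost of layers is not multiplied by `c`.  The radius of the bags is logarithmic in `c |S|`,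
that is, roughly in `log N`.  The number of bags is linear in `c` and polynomial in the radius
(`card_le_of_pairwise_touch`): among many sets that touch pairwise and cover each vertex at most `c`
times, an averaging argument finds some whose connections avoid each other, hence a shallow clique
minor, and its density is bounded by the expansion.  The outliers are the centres of the clusters in
the bags; their number is `c ^ 2` times a polynomial in `t` and `log (c N)`, so that a third factor
`c` absorbs the powers of `log c`.
-/

namespace SimpleGraph

/-! ### Centred sets and shallow clique minors -/

section ShallowMinors

variable {V : Type*} {G : SimpleGraph V}

/-- Some walk of `G` from `z` to `u` has length at most `R` and stays inside `U`. -/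
def ReachWithin (G : SimpleGraph V) (U : Set V) (R : ℕ) (z u : V) : Prop :=
  ∃ P : G.Walk z u, P.length ≤ R ∧ ∀ x ∈ P.support, x ∈ U

/-- `A` and `B` share a vertex or are joined by an edge of `G`. -/
def Touch (G : SimpleGraph V) (A B : Set V) : Prop :=
  ∃ u ∈ A, ∃ v ∈ B, u = v ∨ G.Adj u v

lemma ReachWithin.mono {U U' : Set V} {R R' : ℕ} {z u : V} (h : G.ReachWithin U R z u)
    (hU : U ⊆ U') (hR : R ≤ R') : G.ReachWithin U' R' z u := by
  obtain ⟨P, hP, hs⟩ := h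
  exact ⟨P, hP.trans hR, fun x hx => hU (hs x hx)⟩

lemma ReachWithin.refl {U : Set V} {R : ℕ} {z : V} (h : z ∈ U) : G.ReachWithin U R z z :=
  ⟨Walk.nil, by simp, by simpa using h⟩

lemma ReachWithin.symm {U : Set V} {R : ℕ} {z u : V} (h : G.ReachWithin U R z u) :
    G.ReachWithin U R u z := by
  obtain ⟨P, hP, hs⟩ := h
  exact ⟨P.reverse, by simpa using hP, by simpa using hs⟩

lemma ReachWithin.trans {U : Set V} {R R' : ℕ} {x y z : V} (h : G.ReachWithin U R x y)
    (h' : G.ReachWithin U R' y z) : G.ReachWithin U (R + R') x z := by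
  obtain ⟨P, hP, hs⟩ := h
  obtain ⟨Q, hQ, hs'⟩ := h'
  refine ⟨P.append Q, by rw [Walk.length_append]; omega, fun w hw => ?_⟩
  rcases Walk.mem_support_append_iff _ _ |>.1 hw with h | h
  exacts [hs _ h, hs' _ h]

lemma ReachWithin.of_adj {U : Set V} {x y : V} (hx : x ∈ U) (hy : y ∈ U) (h : x = y ∨ G.Adj x y) :
    G.ReachWithin U 1 x y := by
  rcases h with rfl | h
  · exact ReachWithin.refl hx
  · exact ⟨h.toWalk, by simp, by simp [hx, hy]⟩

lemma ReachWithin.mem_right {U : Set V} {R : ℕ} {z u : V} (h : G.ReachWithin U R z u) : u ∈ U := by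
  obtain ⟨P, -, hs⟩ := h
  exact hs _ P.end_mem_support

lemma Touch.symm {A B : Set V} (h : G.Touch A B) : G.Touch B A := by
  obtain ⟨u, hu, v, hv, h⟩ := h
  exact ⟨v, hv, u, hu, h.imp Eq.symm Adj.symm⟩

lemma Touch.mono {A B A' B' : Set V} (h : G.Touch A B) (hA : A ⊆ A') (hB : B ⊆ B') :
    G.Touch A' B' := by
  obtain ⟨u, hu, v, hv, h⟩ := h
  exact ⟨u, hA hu, v, hB hv, h⟩

lemma isDepthMinor_of_reachWithin {ι : Type*} {R : ℕ} {H : SimpleGraph ι} (W : ι → Set V)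
    (z : ι → V) (hz : ∀ i, z i ∈ W i) (hW : ∀ i, ∀ u ∈ W i, G.ReachWithin (W i) R (z i) u)
    (hd : ∀ i j, i ≠ j → Disjoint (W i) (W j))
    (hH : ∀ i j, H.Adj i j → ∃ x ∈ W i, ∃ y ∈ W j, G.Adj x y) : IsDepthMinor R H G := by
  refine ⟨fun i => (⊤ : G.Subgraph).induce (W i), fun i => ?_, fun i j hij => hd i j hij, hH⟩
  rw [← induce_eq_coe_induce_top]
  refine (radius_le_eccent (u := (⟨z i, hz i⟩ : W i))).trans ?_
  rw [eccent_le_iff]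
  rintro ⟨u, hu⟩
  obtain ⟨P, hP, hs⟩ := hW i u hu
  refine (Walk.edist_le (P.induce (W i) hs)).trans ?_
  have hl : (P.induce (W i) hs).length = P.length := by
    have h := congrArg Walk.length (P.map_induce hs)
    exact (Walk.length_map _ _).symm.trans h
  rw [hl]
  exact_mod_cast hP

lemma card_le_of_top_isDepthMinor {m R d : ℕ} (h : IsDepthMinor R (⊤ : SimpleGraph (Fin m)) G)
    (hd : G.nabla R ≤ d) : m ≤ 2 * d + 1 := by
  have h1 : (⊤ : SimpleGraph (Fin m)).density ≤ d := by
    refine le_trans ?_ hd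
    exact le_iSup_of_le m (le_iSup_of_le ⊤ (le_iSup_of_le h le_rfl))
  rcases Nat.eq_zero_or_pos m with rfl | hm
  · omega
  rw [density, ENNReal.div_le_iff (by simp; omega) (by simp)] at h1
  have h2 : (⊤ : SimpleGraph (Fin m)).edgeSet.ncard = m.choose 2 := by
    classical
    rw [← coe_edgeFinset, Set.ncard_coe_finset, card_edgeFinset_top_eq_card_choose_two]
    simp
  rw [h2, Nat.card_eq_fintype_card, Fintype.card_fin] at h1
  have h3 : m.choose 2 ≤ d * m := by exact_mod_cast h1
  have h4 : m * (m - 1) ≤ 2 * (d * m) := by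
    have := Nat.triangle_succ (m - 1)
    rw [Nat.choose_two_right] at h3
    have h5 : 2 ∣ m * (m - 1) := (Nat.even_mul_pred_self m).two_dvd
    omega
  have h5 : m - 1 ≤ 2 * d := by
    refine Nat.le_of_mul_le_mul_left (c := m) ?_ hm
    linarith
  omega

/-- Starting outside `A`, a walk that meets `A` has an initial part that avoids `A` and whose last
vertex is adjacent to a vertex of `A` on the walk. -/
lemma Walk.exists_prefix_avoiding (A : Set V) {u v : V} (P : G.Walk u v) (hu : u ∉ A)
    (hv : ∃ a ∈ P.support, a ∈ A) :
    ∃ (x y : V) (Q : G.Walk u x), Q.length ≤ P.length ∧ (∀ w ∈ Q.support, w ∈ P.support ∧ w ∉ A) ∧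
      y ∈ P.support ∧ y ∈ A ∧ G.Adj x y := by
  induction P with
  | nil => obtain ⟨a, ha, haA⟩ := hv; simp at ha; subst ha; exact absurd haA hu
  | @cons u w v h P ih =>
    by_cases hw : w ∈ A
    · exact ⟨u, w, Walk.nil, by simp, by simpa using hu, by simp, hw, h⟩
    · obtain ⟨a, ha, haA⟩ := hv
      have ha' : a ∈ P.support := by
        rcases List.mem_cons.1 (by simpa using ha) with rfl | h
        · exact absurd haA hu
        · exact h
      obtain ⟨x, y, Q, hQ, hQs, hy, hyA, hxy⟩ := ih hw ⟨a, ha', haA⟩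
      refine ⟨x, y, Q.cons h, by simpa using hQ, ?_, by simp [hy], hyA, hxy⟩
      intro b hb
      rcases List.mem_cons.1 (by simpa using hb) with rfl | hb
      · exact ⟨by simp, hu⟩
      · exact ⟨by simp [(hQs b hb).1], (hQs b hb).2⟩

open Classical in
/-- Two touching centred sets `U` and `U'` are linked by a short path from one centre to the other
that leaves `U \ U'` once and then stays in `U'`.  The path is recorded by the vertex sets `L` and
`L'` of its two parts, and `z ∈ K` is kept even if `z ∈ U'`, when no such path exists. -/
lemma exists_link {U U' : Set V} {R : ℕ} {z z' : V}
    (hU : ∀ u ∈ U, G.ReachWithin U R z u) (hU' : ∀ u ∈ U', G.ReachWithin U' R z' u)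
    (ht : G.Touch U U') :
    ∃ K : Finset V, z ∈ K ∧ K.card ≤ 2 * R + 2 ∧ (z ∉ U' → ∃ L L' : Finset V, L ⊆ K ∧ L' ⊆ K ∧
      (∀ u ∈ L, u ∈ U ∧ u ∉ U' ∧ G.ReachWithin L R z u) ∧
      (∀ u ∈ L', u ∈ U' ∧ G.ReachWithin L' R z' u) ∧ ∃ x ∈ L, ∃ y ∈ L', G.Adj x y) := by
  by_cases hzU : z ∈ U'
  · exact ⟨{z}, by simp, by simp, fun h => absurd hzU h⟩
  obtain ⟨x, y, Q, hQ, hQs, hyU, hxy⟩ : ∃ (x y : V) (Q : G.Walk z x), Q.length ≤ R ∧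
      (∀ w ∈ Q.support, w ∈ U ∧ w ∉ U') ∧ y ∈ U' ∧ G.Adj x y := by
    obtain ⟨a, ha, b, hb, hab⟩ := ht
    obtain ⟨P, hP, hPs⟩ := hU a ha
    by_cases hP' : ∃ a ∈ P.support, a ∈ U'
    · obtain ⟨x, y, Q, hQ, hQs, hy, hyU, hxy⟩ := P.exists_prefix_avoiding U' hzU hP'
      exact ⟨x, y, Q, hQ.trans hP, fun w hw => ⟨hPs _ (hQs w hw).1, (hQs w hw).2⟩, hyU, hxy⟩
    · push Not at hP'
      rcases hab with rfl | hab
      · exact absurd hb (hP' a P.end_mem_support)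
      · exact ⟨a, b, P, hP, fun w hw => ⟨hPs w hw, hP' w hw⟩, hb, hab⟩
  obtain ⟨P, hP, hPs⟩ := hU' y hyU
  have key : ∀ {s e : V} (W : G.Walk s e), W.length ≤ R →
      ∀ u ∈ W.support.toFinset, G.ReachWithin W.support.toFinset R s u := by
    intro s e W hW u hu
    have hu' : u ∈ W.support := by simpa using hu
    refine ⟨W.takeUntil u hu', (W.length_takeUntil_le_length hu').trans hW, fun x hx => ?_⟩
    simpa using W.support_takeUntil_subset_support hu' hx
  refine ⟨Q.support.toFinset ∪ P.support.toFinset, by simp, ?_, fun _ =>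
    ⟨Q.support.toFinset, P.support.toFinset, Finset.subset_union_left, Finset.subset_union_right,
      fun u hu => ⟨(hQs u (by simpa using hu)).1, (hQs u (by simpa using hu)).2, key Q hQ u hu⟩,
      fun u hu => ⟨hPs u (by simpa using hu), key P hP u hu⟩, x, by simp, y, by simp, hxy⟩⟩
  refine (Finset.card_union_le _ _).trans ?_
  have h1 := List.toFinset_card_le Q.support
  have h2 := List.toFinset_card_le P.support
  rw [Walk.length_support] at h1 h2
  omega

/-- If no link between two of the sets meets a third one, the links cut the overlapping sets `U i`
down to the bags of a shallow clique minor. -/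
lemma isDepthMinor_top_of_links {m R : ℕ} (hm : 3 ≤ m) (U : Fin m → Set V) (z : Fin m → V)
    (hz : ∀ i, z i ∈ U i) (K : Fin m → Fin m → Finset V) (hzK : ∀ i j, z i ∈ K i j)
    (hK : ∀ i j b, i ≠ j → b ≠ i → b ≠ j → ∀ v ∈ K i j, v ∉ U b)
    (hL : ∀ i j, i ≠ j → z i ∉ U j → ∃ L L' : Finset V, L ⊆ K i j ∧ L' ⊆ K i j ∧
      (∀ u ∈ L, u ∈ U i ∧ u ∉ U j ∧ G.ReachWithin L R (z i) u) ∧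
      (∀ u ∈ L', u ∈ U j ∧ G.ReachWithin L' R (z j) u) ∧ ∃ x ∈ L, ∃ y ∈ L', G.Adj x y) :
    IsDepthMinor R (⊤ : SimpleGraph (Fin m)) G := by
  have hzU : ∀ i j, i ≠ j → z i ∉ U j := by
    intro i j hij
    -- a third index exists, and the link from `i` to it contains the centre of `U i`
    obtain ⟨l, hl⟩ : ∃ l : Fin m, l ∉ ({i, j} : Finset (Fin m)) := by
      by_contra! h
      have h1 := Finset.card_le_card (fun x _ => h x : (Finset.univ : Finset (Fin m)) ⊆ _)
      have h2 := Finset.card_le_two (a := i) (b := j)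
      rw [Finset.card_univ, Fintype.card_fin] at h1
      omega
    simp only [Finset.mem_insert, Finset.mem_singleton, not_or] at hl
    exact hK i l j (Ne.symm hl.1) hij.symm (Ne.symm hl.2) _ (hzK i l)
  have hL' := fun i j (h : i ≠ j) => hL i j h (hzU i j h)
  choose! L L' hLK hLK' hLU hLU' hadj using hL'
  let W : Fin m → Set V := fun i =>
    {v | v = z i ∨ (∃ j, i < j ∧ v ∈ L i j) ∨ ∃ j, j < i ∧ v ∈ L' j i}
  have hWU : ∀ i, W i ⊆ U i := by
    rintro i v (rfl | ⟨j, hj, hv⟩ | ⟨j, hj, hv⟩)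
    · exact hz i
    · exact (hLU i j hj.ne v hv).1
    · exact (hLU' j i hj.ne v hv).1
  have hdis : ∀ i j, i < j → Disjoint (W i) (W j) := by
    intro i j hij
    rw [Set.disjoint_left]
    intro v hv hvj
    have hvU := hWU j hvj
    rcases hv with rfl | ⟨l, hl, hv⟩ | ⟨l, hl, hv⟩
    · exact hzU i j hij.ne hvU
    · by_cases hlj : l = j
      · subst hlj
        exact (hLU i l hl.ne v hv).2.1 hvU
      · exact hK i l j hl.ne hij.ne' (Ne.symm hlj) v (hLK i l hl.ne hv) hvU
    · exact hK l i j hl.ne (hl.trans hij).ne' hij.ne' v (hLK' l i hl.ne hv) hvU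
  have hadj' : ∀ i j, i < j → ∃ x ∈ W i, ∃ y ∈ W j, G.Adj x y := by
    intro i j hij
    obtain ⟨x, hx, y, hy, hxy⟩ := hadj i j hij.ne
    exact ⟨x, Or.inr (Or.inl ⟨j, hij, hx⟩), y, Or.inr (Or.inr ⟨i, hij, hy⟩), hxy⟩
  refine isDepthMinor_of_reachWithin W z (fun i => Or.inl rfl) ?_ ?_ ?_
  · rintro i u (rfl | ⟨j, hj, hu⟩ | ⟨j, hj, hu⟩)
    · exact ReachWithin.refl (Or.inl rfl)
    · exact (hLU i j hj.ne u hu).2.2.mono (fun v hv => Or.inr (Or.inl ⟨j, hj, hv⟩)) le_rfl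
    · exact (hLU' j i hj.ne u hu).2.mono (fun v hv => Or.inr (Or.inr ⟨j, hj, hv⟩)) le_rfl
  · intro i j hij
    rcases lt_or_gt_of_ne hij with h | h
    exacts [hdis i j h, (hdis j i h).symm]
  · intro i j hij
    rcases lt_or_gt_of_ne hij.ne with h | h
    · exact hadj' i j h
    · obtain ⟨x, hx, y, hy, hxy⟩ := hadj' j i h
      exact ⟨y, hy, x, hx, hxy.symm⟩

open Classical in
/-- Averaging: some `m`-subset of `I` contains at most the proportional share of the triples `T` of
distinct elements.  Elements of `I` lying in many triples are removed one by one. -/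
lemma exists_subset_card_few_triples {ι : Type*} (I : Finset ι) (T : Finset (ι × ι × ι))
    (hT : ∀ t ∈ T, t.1 ≠ t.2.1 ∧ t.1 ≠ t.2.2 ∧ t.2.1 ≠ t.2.2) {m : ℕ} (hm : m ≤ I.card) :
    ∃ J ⊆ I, J.card = m ∧
      (T.filter fun t => t.1 ∈ J ∧ t.2.1 ∈ J ∧ t.2.2 ∈ J).card * I.card.descFactorial 3 ≤
        T.card * m.descFactorial 3 := by
  obtain ⟨d, hd⟩ : ∃ d, m + d = I.card := ⟨I.card - m, by omega⟩
  clear hm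
  induction d generalizing m with
  | zero =>
    exact ⟨I, subset_rfl, by omega, by
      rw [show m = I.card by omega]; gcongr; exact Finset.filter_subset _ _⟩
  | succ d ih =>
    obtain ⟨J, hJI, hJ, hcount⟩ := ih (m := m + 1) (by omega)
    set F : Finset ι → Finset (ι × ι × ι) := fun J =>
      T.filter fun t => t.1 ∈ J ∧ t.2.1 ∈ J ∧ t.2.2 ∈ J with hF
    have hsum : ∑ i ∈ J, (F (J.erase i)).card = (F J).card * (J.card - 3) := by
      have h1 : ∀ i ∈ J, (F (J.erase i)).card =
          ((F J).filter fun t => i ∉ ({t.1, t.2.1, t.2.2} : Finset ι)).card := by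
        intro i _
        congr 1
        ext t
        simp only [hF, Finset.mem_filter, Finset.mem_erase, Finset.mem_insert,
          Finset.mem_singleton, not_or]
        grind
      rw [Finset.sum_congr rfl h1]
      simp_rw [Finset.card_filter]
      rw [Finset.sum_comm, Finset.sum_const_nat]
      intro t ht
      obtain ⟨htT, h1, h2, h3⟩ := Finset.mem_filter.1 ht
      obtain ⟨d1, d2, d3⟩ := hT t htT
      rw [← Finset.card_filter]
      have h4 : (J.filter fun i => i ∉ ({t.1, t.2.1, t.2.2} : Finset ι)) =
          J \ {t.1, t.2.1, t.2.2} := by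
        ext i; simp
      rw [h4, Finset.card_sdiff_of_subset (by
        intro i hi
        simp only [Finset.mem_insert, Finset.mem_singleton] at hi
        rcases hi with rfl | rfl | rfl <;> assumption), Finset.card_eq_three.2
        ⟨_, _, _, d1, d2, d3, rfl⟩]
    obtain ⟨i, hi, hle⟩ : ∃ i ∈ J, J.card * (F (J.erase i)).card ≤ (F J).card * (J.card - 3) := by
      by_contra! h
      have hne : J.Nonempty := Finset.card_pos.1 (by omega)
      have h1 := Finset.sum_lt_sum_of_nonempty hne h
      rw [Finset.sum_const, smul_eq_mul, ← Finset.mul_sum, hsum] at h1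
      exact lt_irrefl _ h1
    refine ⟨J.erase i, (Finset.erase_subset _ _).trans hJI, by
      rw [Finset.card_erase_of_mem hi]; omega, ?_⟩
    change (F (J.erase i)).card * _ ≤ _
    change (F J).card * _ ≤ _ at hcount
    rw [hJ] at hle
    refine Nat.le_of_mul_le_mul_left (c := m + 1) ?_ (Nat.succ_pos m)
    have hf : (m + 1 - 3) * (m + 1).descFactorial 3 = (m + 1) * m.descFactorial 3 := by
      simp only [Nat.descFactorial]
      rcases m with _ | _ | m
      · simp
      · simp
      · simp only [Nat.add_sub_cancel, Nat.reduceSubDiff, tsub_zero, mul_one]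
        ring
    calc (m + 1) * ((F (J.erase i)).card * I.card.descFactorial 3)
        = (m + 1) * (F (J.erase i)).card * I.card.descFactorial 3 := by ring
      _ ≤ (F J).card * (m + 1 - 3) * I.card.descFactorial 3 := by gcongr
      _ = (m + 1 - 3) * ((F J).card * I.card.descFactorial 3) := by ring
      _ ≤ (m + 1 - 3) * (T.card * (m + 1).descFactorial 3) := by gcongr
      _ = T.card * ((m + 1 - 3) * (m + 1).descFactorial 3) := by ring
      _ = (m + 1) * (T.card * m.descFactorial 3) := by rw [hf]; ring

open Classical in
/-- A family of pairwise touching sets of radius `R` that covers each vertex at most `c` times has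
a size bounded linearly in `c` and polynomially in `R` and the density `d` of depth-`R` minors:
few triples consist of a link between two sets and a third set meeting the link, so a large
subfamily without such triples exists, and it gives a clique minor. -/
theorem card_le_of_pairwise_touch {ι : Type*} (I : Finset ι) (U : ι → Set V) (z : ι → V)
    {R c d : ℕ} (hz : ∀ i ∈ I, z i ∈ U i) (hU : ∀ i ∈ I, ∀ u ∈ U i, G.ReachWithin (U i) R (z i) u)
    (ht : ∀ i ∈ I, ∀ j ∈ I, i ≠ j → G.Touch (U i) (U j))
    (hc : ∀ v, (I.filter fun i => v ∈ U i).card ≤ c) (hd : G.nabla R ≤ d) :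
    I.card ≤ (2 * R + 2) * c * (2 * d + 3) ^ 3 + 2 * d + 5 := by
  by_contra! hI
  set k := I.card
  set m := 2 * d + 3 with hm
  have hlink := fun (i : ι) (hi : i ∈ I) (j : ι) (hj : j ∈ I) (hij : i ≠ j) =>
    exists_link (hU i hi) (hU j hj) (ht i hi j hj hij)
  choose! K hzK hKc hL using hlink
  set T : Finset (ι × ι × ι) := (I ×ˢ I ×ˢ I).filter fun t =>
    t.1 ≠ t.2.1 ∧ t.1 ≠ t.2.2 ∧ t.2.1 ≠ t.2.2 ∧ ∃ v ∈ K t.1 t.2.1, v ∈ U t.2.2 with hTdef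
  have hTcard : T.card ≤ k * (k - 1) * ((2 * R + 2) * c) := by
    have h1 : T ⊆ I.offDiag.biUnion fun p => ((K p.1 p.2).biUnion fun v =>
        I.filter fun i => v ∈ U i).image fun b => (p.1, p.2, b) := by
      rintro ⟨i, j, b⟩ h
      simp only [hTdef, Finset.mem_filter, Finset.mem_product] at h
      obtain ⟨⟨hi, hj, hb⟩, hij, -, -, v, hv, hvU⟩ := h
      simp only [Finset.mem_biUnion, Finset.mem_image, Finset.mem_offDiag, Finset.mem_filter]
      exact ⟨(i, j), ⟨hi, hj, hij⟩, b, ⟨v, hv, hb, hvU⟩, rfl⟩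
    refine (Finset.card_le_card h1).trans ?_
    refine (Finset.card_biUnion_le_card_mul _ _ ((2 * R + 2) * c) ?_).trans ?_
    · rintro ⟨i, j⟩ hp
      obtain ⟨hi, hj, hij⟩ := Finset.mem_offDiag.1 hp
      refine Finset.card_image_le.trans ?_
      exact (Finset.card_biUnion_le_card_mul _ _ c fun v _ => hc v).trans
        (Nat.mul_le_mul_right _ (hKc i hi j hj hij))
    · rw [Finset.offDiag_card, Nat.mul_sub_one]
  obtain ⟨J, hJI, hJ, hcount⟩ := exists_subset_card_few_triples I T (fun t h => by
    simp only [hTdef, Finset.mem_filter] at h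
    exact ⟨h.2.1, h.2.2.1, h.2.2.2.1⟩) (m := m) (by omega)
  have hempty : (T.filter fun t => t.1 ∈ J ∧ t.2.1 ∈ J ∧ t.2.2 ∈ J).card = 0 := by
    by_contra hne
    change _ * k.descFactorial 3 ≤ _ at hcount
    have h1 : k.descFactorial 3 ≤ T.card * m.descFactorial 3 :=
      (Nat.le_mul_of_pos_left _ (Nat.pos_of_ne_zero hne)).trans hcount
    have h2 : m.descFactorial 3 ≤ m ^ 3 := Nat.descFactorial_le_pow _ _
    have h3 : k.descFactorial 3 = k * (k - 1) * (k - 2) := by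
      simp [Nat.descFactorial]; ring
    have h4 : k * (k - 1) * (k - 2) ≤ k * (k - 1) * ((2 * R + 2) * c * m ^ 3) := by
      rw [← h3]
      calc _ ≤ T.card * m.descFactorial 3 := h1
        _ ≤ (k * (k - 1) * ((2 * R + 2) * c)) * m ^ 3 := Nat.mul_le_mul hTcard h2
        _ = _ := by ring
    have h5 := Nat.le_of_mul_le_mul_left h4 (Nat.mul_pos (by omega) (by omega))
    omega
  have hgood : ∀ i ∈ J, ∀ j ∈ J, ∀ b ∈ J, i ≠ j → b ≠ i → b ≠ j → ∀ v ∈ K i j, v ∉ U b := by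
    intro i hi j hj b hb hij hbi hbj v hv hvU
    have : (i, j, b) ∈ T.filter fun t => t.1 ∈ J ∧ t.2.1 ∈ J ∧ t.2.2 ∈ J := by
      simp only [hTdef, Finset.mem_filter, Finset.mem_product]
      exact ⟨⟨⟨hJI hi, hJI hj, hJI hb⟩, hij, hbi.symm, hbj.symm, v, hv, hvU⟩, hi, hj, hb⟩
    rw [Finset.card_eq_zero.1 hempty] at this
    simp at this
  let e : Fin m ≃ J := (Finset.equivFinOfCardEq hJ).symm
  have hne : ∀ {i j}, i ≠ j → (e i : ι) ≠ e j := fun h h' => h (e.injective (Subtype.ext h'))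
  have hmin : IsDepthMinor R (⊤ : SimpleGraph (Fin m)) G := by
    refine isDepthMinor_top_of_links (by omega) (fun i => U (e i)) (fun i => z (e i))
      (fun i => hz _ (hJI (e i).2)) (fun i j => if i = j then {z (e i)} else K (e i) (e j))
      ?_ ?_ ?_
    · intro i j
      split_ifs with h
      · simp
      · exact hzK _ (hJI (e i).2) _ (hJI (e j).2) (hne h)
    · intro i j b hij hbi hbj
      rw [if_neg hij]
      exact hgood _ (e i).2 _ (e j).2 _ (e b).2 (hne hij) (hne hbi) (hne hbj)
    · intro i j hij hzU
      rw [if_neg hij]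
      exact hL _ (hJI (e i).2) _ (hJI (e j).2) (hne hij) hzU
  have := card_le_of_top_isDepthMinor hmin hd
  omega

end ShallowMinors

/-! ### Separating a system of clusters -/

section Clusters

variable {V ι : Type*} {G : SimpleGraph V} {T : ι → Finset V}

open Classical in
/-- The clusters of `B` at distance at most `j` from the cluster `v`, where two clusters are
adjacent if they touch. -/
noncomputable def touchBall (G : SimpleGraph V) (T : ι → Finset V) (B : Finset ι) (v : ι) :
    ℕ → Finset ι
  | 0 => {v}
  | j + 1 => B.filter fun x => ∃ y ∈ touchBall G T B v j, G.Touch (T x) (T y)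

lemma mem_touchBall_succ {B : Finset ι} {v x : ι} {j : ℕ} : x ∈ G.touchBall T B v (j + 1) ↔
    x ∈ B ∧ ∃ y ∈ G.touchBall T B v j, G.Touch (T x) (T y) := by
  simp [touchBall]

lemma touchBall_subset {B : Finset ι} {v : ι} (hv : v ∈ B) (j : ℕ) : G.touchBall T B v j ⊆ B := by
  cases j with
  | zero => simpa [touchBall] using hv
  | succ j => exact fun x hx => (mem_touchBall_succ.1 hx).1

lemma touchBall_mono {B : Finset ι} {v : ι} (hv : v ∈ B) (hB : ∀ x ∈ B, (T x).Nonempty) :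
    Monotone (G.touchBall T B v) := by
  refine monotone_nat_of_le_succ fun j x hx => ?_
  have hxB := touchBall_subset hv j hx
  obtain ⟨u, hu⟩ := hB x hxB
  exact mem_touchBall_succ.2 ⟨hxB, x, hx, u, hu, u, hu, Or.inl rfl⟩

lemma mem_touchBall_add {B : Finset ι} {v w y : ι} (hw : w ∈ B) {e j : ℕ}
    (hyw : y ∈ G.touchBall T B w j) (hyv : y ∈ G.touchBall T B v e) :
    w ∈ G.touchBall T B v (e + j) := by
  induction j generalizing e y with
  | zero => simp only [touchBall, Finset.mem_singleton] at hyw; subst hyw; simpa using hyv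
  | succ j ih =>
    obtain ⟨-, y', hy', ht⟩ := mem_touchBall_succ.1 hyw
    have := ih hy' (mem_touchBall_succ.2 ⟨touchBall_subset hw j hy', y, hyv, ht.symm⟩)
    rwa [show e + 1 + j = e + (j + 1) by omega] at this

variable [DecidableEq V]

lemma disjoint_biUnion_of_not_touch {Y Y' : Finset ι}
    (h : ∀ x ∈ Y, ∀ y ∈ Y', ¬ G.Touch (T x) (T y)) : Disjoint (Y.biUnion T) (Y'.biUnion T) := by
  rw [Finset.disjoint_left]
  intro v hv hv'
  obtain ⟨x, hx, hvx⟩ := Finset.mem_biUnion.1 hv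
  obtain ⟨y, hy, hvy⟩ := Finset.mem_biUnion.1 hv'
  exact h x hx y hy ⟨v, hvx, v, hvy, Or.inl rfl⟩

/-- The total cost of the vertices in the clusters of `Y`, plus `δ` for each cluster. -/
noncomputable def clusterWeight (T : ι → Finset V) (ρ : V → ℝ) (δ : ℝ) (Y : Finset ι) : ℝ :=
  ∑ v ∈ Y.biUnion T, ρ v + Y.card * δ

lemma clusterWeight_mono {ρ : V → ℝ} (hρ : ∀ v, 0 ≤ ρ v) {δ : ℝ} (hδ : 0 ≤ δ) {Y Y' : Finset ι}
    (h : Y ⊆ Y') : clusterWeight T ρ δ Y ≤ clusterWeight T ρ δ Y' := by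
  unfold clusterWeight
  have h1 := Finset.sum_le_sum_of_subset_of_nonneg
    (Finset.biUnion_subset_biUnion_of_subset_left T h) (fun v _ _ => hρ v)
  have h2 : (Y.card : ℝ) ≤ Y'.card := by exact_mod_cast Finset.card_le_card h
  gcongr

lemma sum_biUnion_le_clusterWeight {ρ : V → ℝ} {δ : ℝ} (hδ : 0 ≤ δ) (Y : Finset ι) :
    ∑ v ∈ Y.biUnion T, ρ v ≤ clusterWeight T ρ δ Y := by
  have : 0 ≤ (Y.card : ℝ) * δ := by positivity
  unfold clusterWeight
  linarith

variable [DecidableEq ι]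

lemma clusterWeight_add_le {ρ : V → ℝ} (hρ : ∀ v, 0 ≤ ρ v) {δ : ℝ} (hδ : 0 ≤ δ)
    {Y Y' Y'' : Finset ι} (hd : Disjoint Y Y') (ht : ∀ x ∈ Y, ∀ y ∈ Y', ¬ G.Touch (T x) (T y))
    (h : Y ⊆ Y'') (h' : Y' ⊆ Y'') :
    clusterWeight T ρ δ Y + clusterWeight T ρ δ Y' ≤ clusterWeight T ρ δ Y'' := by
  refine le_trans (le_of_eq ?_) (clusterWeight_mono hρ hδ (Finset.union_subset h h'))
  unfold clusterWeight
  rw [Finset.union_biUnion, Finset.sum_union (disjoint_biUnion_of_not_touch ht),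
    Finset.card_union_of_disjoint hd]
  push_cast
  ring

/-- A cluster in a ball is joined to the centre of the ball by a chain of clusters whose union has
small radius. -/
lemma exists_chain {B : Finset ι} {ctr : ι → V} {r : ℕ}
    (hT : ∀ x ∈ B, ∀ u ∈ T x, G.ReachWithin (T x) r (ctr x) u) {v : ι} (hv : v ∈ B) (j : ℕ) :
    ∀ w ∈ G.touchBall T B v j, ∃ P ⊆ B, v ∈ P ∧ w ∈ P ∧ P.card ≤ j + 1 ∧
      ∀ u ∈ P.biUnion T,
        G.ReachWithin (P.biUnion T : Finset V) (j * (2 * r + 1) + r) (ctr v) u := by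
  induction j with
  | zero =>
    intro w hw
    simp only [touchBall, Finset.mem_singleton] at hw
    subst hw
    refine ⟨{w}, by simpa using hv, by simp, by simp, by simp, fun u hu => ?_⟩
    rw [Finset.singleton_biUnion] at hu ⊢
    simpa using hT w hv u hu
  | succ j ih =>
    intro w hw
    obtain ⟨hwB, y, hy, a, ha, b, hb, hab⟩ := mem_touchBall_succ.1 hw
    obtain ⟨P, hPB, hvP, hyP, hcard, hP⟩ := ih y hy
    refine ⟨insert w P, Finset.insert_subset hwB hPB, by simp [hvP], by simp,
      (Finset.card_insert_le _ _).trans (by omega), fun u hu => ?_⟩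
    have hsub : ((P.biUnion T : Finset V) : Set V) ⊆ ((insert w P).biUnion T : Finset V) := by
      exact_mod_cast Finset.biUnion_subset_biUnion_of_subset_left _ (Finset.subset_insert _ _)
    have hsub' : ((T w : Finset V) : Set V) ⊆ ((insert w P).biUnion T : Finset V) := by
      exact_mod_cast Finset.subset_biUnion_of_mem T (Finset.mem_insert_self w P)
    rw [Finset.biUnion_insert, Finset.mem_union] at hu
    rcases hu with hu | hu
    · have h1 := (hP b (Finset.mem_biUnion.2 ⟨y, hyP, hb⟩)).mono hsub le_rfl
      have h2 : G.ReachWithin ((insert w P).biUnion T : Finset V) 1 b a :=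
        ReachWithin.of_adj h1.mem_right (hsub' ha) (hab.imp Eq.symm Adj.symm)
      have h3 := (hT w hwB a ha).symm.mono hsub' le_rfl
      have h4 := (hT w hwB u hu).mono hsub' le_rfl
      exact (((h1.trans h2).trans h3).trans h4).mono subset_rfl (by ring_nf; omega)
    · exact (hP u hu).mono hsub (by gcongr; omega)

/-- While no second layer around `v` is cheap, the weight of the balls around `v` grows by the
factor `1 + 1 / l` every two steps. -/
lemma exists_cheap_layer {B : Finset ι} {v : ι} (hv : v ∈ B) (hB : ∀ x ∈ B, (T x).Nonempty)
    {ρ : V → ℝ} (hρ : ∀ v, 0 ≤ ρ v) {δ : ℝ} (hδ : 0 ≤ δ) {l κ : ℕ} (hl : 1 ≤ l)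
    (hκ : clusterWeight T ρ δ B < 2 ^ κ * δ) :
    ∃ j ≤ 2 * (l * κ), (l : ℝ) * ∑ v ∈ (G.touchBall T B v (j + 2) \
      G.touchBall T B v (j + 1)).biUnion T, ρ v ≤ clusterWeight T ρ δ (G.touchBall T B v j) := by
  by_contra! hcon
  have hl0 : (0 : ℝ) < l := by exact_mod_cast hl
  have hmono := touchBall_mono (G := G) hv hB
  have hgrow : ∀ i ≤ l * κ,
      (1 + 1 / (l : ℝ)) ^ i * δ ≤ clusterWeight T ρ δ (G.touchBall T B v (2 * i)) := by
    intro i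
    induction i with
    | zero =>
      intro _
      have : 0 ≤ ∑ u ∈ T v, ρ u := Finset.sum_nonneg fun u _ => hρ u
      simpa [touchBall, clusterWeight] using this
    | succ i ih =>
      intro hi
      have h1 := ih (by omega)
      have h2 := hcon (2 * i) (by omega)
      set Y := G.touchBall T B v (2 * i)
      set L := G.touchBall T B v (2 * i + 2) \ G.touchBall T B v (2 * i + 1)
      have h3 : clusterWeight T ρ δ Y + clusterWeight T ρ δ L ≤
          clusterWeight T ρ δ (G.touchBall T B v (2 * (i + 1))) := by
        refine clusterWeight_add_le (G := G) hρ hδ ?_ ?_ (hmono (by omega)) Finset.sdiff_subset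
        · exact Finset.disjoint_sdiff.mono_left (hmono (by omega))
        · intro x hx y hy ht
          obtain ⟨hy1, hy2⟩ := Finset.mem_sdiff.1 hy
          exact hy2 (mem_touchBall_succ.2 ⟨touchBall_subset hv _ hy1, x, hx, ht.symm⟩)
      have h4 : clusterWeight T ρ δ Y / l ≤ clusterWeight T ρ δ L := by
        rw [div_le_iff₀ hl0, mul_comm]
        refine h2.le.trans ?_
        gcongr
        exact sum_biUnion_le_clusterWeight hδ L
      calc (1 + 1 / (l : ℝ)) ^ (i + 1) * δ = (1 + 1 / (l : ℝ)) * ((1 + 1 / (l : ℝ)) ^ i * δ) := by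
            ring
        _ ≤ (1 + 1 / (l : ℝ)) * clusterWeight T ρ δ Y := by gcongr
        _ = clusterWeight T ρ δ Y + clusterWeight T ρ δ Y / l := by ring
        _ ≤ _ := by linarith
  have h1 := hgrow (l * κ) le_rfl
  have h2 : (2 : ℝ) ≤ (1 + 1 / (l : ℝ)) ^ l := by
    have := one_add_mul_le_pow (a := 1 / (l : ℝ)) (by
      have : (0 : ℝ) ≤ 1 / l := by positivity
      linarith) l
    rw [mul_one_div_cancel hl0.ne'] at this
    linarith
  have h3 : (2 : ℝ) ^ κ * δ ≤ (1 + 1 / (l : ℝ)) ^ (l * κ) * δ := by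
    rw [pow_mul]
    gcongr
  have h4 := clusterWeight_mono (T := T) hρ hδ (touchBall_subset (G := G) (T := T) hv
    (2 * (l * κ)))
  linarith

/-- Disjoint sets of clusters whose unions touch pairwise and have radius at most `R`. -/
structure IsBagFamily (G : SimpleGraph V) (T : ι → Finset V) (R : ℕ) (𝓜 : Finset (Finset ι)) :
    Prop where
  disjoint : ∀ M ∈ 𝓜, ∀ M' ∈ 𝓜, M ≠ M' → Disjoint M M'
  touch : ∀ M ∈ 𝓜, ∀ M' ∈ 𝓜, M ≠ M' →
    G.Touch (M.biUnion T : Finset V) (M'.biUnion T : Finset V)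
  centered : ∀ M ∈ 𝓜, ∃ z ∈ M.biUnion T, ∀ u ∈ M.biUnion T,
    G.ReachWithin (M.biUnion T : Finset V) R z u

lemma IsBagFamily.card_le {R c d : ℕ} {𝓜 : Finset (Finset ι)} (h : G.IsBagFamily T R 𝓜)
    {X : Finset ι} (hX : ∀ M ∈ 𝓜, M ⊆ X) (hc : ∀ v, (X.filter fun x => v ∈ T x).card ≤ c)
    (hd : G.nabla R ≤ d) : 𝓜.card ≤ (2 * R + 2) * c * (2 * d + 3) ^ 3 + 2 * d + 5 := by
  classical
  rcases 𝓜.eq_empty_or_nonempty with rfl | ⟨M₀, hM₀⟩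
  · simp
  have hcen := h.centered
  obtain ⟨z₀, hz₀, -⟩ := hcen M₀ hM₀
  obtain ⟨x₀, -, -⟩ := Finset.mem_biUnion.1 hz₀
  have : Nonempty V := ⟨z₀⟩
  have : Nonempty ι := ⟨x₀⟩
  choose! z hz hzR using hcen
  refine card_le_of_pairwise_touch 𝓜 (fun M => (M.biUnion T : Finset V)) z
    (fun M hM => by exact_mod_cast hz M hM) (fun M hM u hu => hzR M hM u (by exact_mod_cast hu))
    h.touch (fun v => ?_) hd
  refine le_trans ?_ (hc v)
  have hx : ∀ M ∈ 𝓜, v ∈ M.biUnion T → ∃ x ∈ M, v ∈ T x := fun M _ hM => by simpa using hM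
  choose! x hxM hvx using hx
  refine Finset.card_le_card_of_injOn x (fun M hM => ?_) fun M hM M' hM' he => ?_
  · simp only [Finset.coe_filter, Set.mem_ofPred_eq, Finset.mem_coe] at hM
    simpa using ⟨hX M hM.1 (hxM M hM.1 hM.2), hvx M hM.1 hM.2⟩
  · simp only [Finset.coe_filter, Set.mem_ofPred_eq, Finset.mem_coe] at hM hM'
    by_contra hne
    have := h.disjoint M hM.1 M' hM'.1 hne
    exact Finset.disjoint_left.1 this (hxM M hM.1 hM.2) (by rw [he]; exact hxM M' hM'.1 hM'.2)

/-- A stage of the separation of the clusters of `X`: `A` is already separated from `B`, which is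
still to be treated, by the cheap clusters `Z` and the bags of `𝓜`.  The bags have at most `s`
clusters and radius at most `R`.  In `cost`, each layer put into `Z` costs at most `1 / l` of the
weight that `B` loses with the ball inside that layer, so `W` bounds the weight of `X`. -/
structure IsStage (G : SimpleGraph V) (T : ι → Finset V) (ρ : V → ℝ) (δ W : ℝ) (X : Finset ι)
    (n l s R : ℕ) (A Z B : Finset ι) (𝓜 : Finset (Finset ι)) : Prop where
  subset : B ⊆ X
  cover : X ⊆ A ∪ Z ∪ B ∪ 𝓜.biUnion id
  not_touch : ∀ x ∈ A, ∀ y ∈ B, ¬ G.Touch (T x) (T y)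
  cost : l * ∑ v ∈ Z.biUnion T, ρ v + clusterWeight T ρ δ B ≤ W
  balanced : 3 * (A.biUnion T).card ≤ 2 * n
  family : G.IsBagFamily T R 𝓜
  bag_subset : ∀ M ∈ 𝓜, M ⊆ X
  bag_disjoint : ∀ M ∈ 𝓜, Disjoint M B
  bag_card : ∀ M ∈ 𝓜, M.card ≤ s

namespace IsStage

variable {ρ : V → ℝ} {δ W : ℝ} {X A Z B : Finset ι} {n l s R : ℕ} {𝓜 : Finset (Finset ι)}

/-- A bag that touches no cluster of `B` can be moved to `A`. -/
lemma erase_bag (h : IsStage G T ρ δ W X n l s R A Z B 𝓜) [Fintype V] (hn : n = Fintype.card V)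
    (hB : 2 * n < 3 * (B.biUnion T).card) {M : Finset ι} (hM : M ∈ 𝓜)
    (hMB : ∀ x ∈ M, ∀ y ∈ B, ¬ G.Touch (T x) (T y)) :
    IsStage G T ρ δ W X n l s R (A ∪ M) Z B (𝓜.erase M) := by
  have hnt : ∀ x ∈ A ∪ M, ∀ y ∈ B, ¬ G.Touch (T x) (T y) := by
    intro x hx
    rcases Finset.mem_union.1 hx with hx | hx
    exacts [h.not_touch x hx, hMB x hx]
  refine ⟨h.subset, ?_, hnt, h.cost, ?_, ⟨?_, ?_, ?_⟩, ?_, ?_, ?_⟩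
  · intro x hx
    have := h.cover hx
    simp only [Finset.mem_union, Finset.mem_biUnion, Finset.mem_erase, id] at this ⊢
    rcases this with ((h1 | h1) | h1) | ⟨M', h1, h2⟩
    · simp [h1]
    · simp [h1]
    · simp [h1]
    · by_cases hMM : M' = M
      · subst hMM; simp [h2]
      · exact Or.inr ⟨M', ⟨hMM, h1⟩, h2⟩
  · have h1 := Finset.card_le_univ ((A ∪ M).biUnion T ∪ B.biUnion T)
    rw [Finset.card_union_of_disjoint (disjoint_biUnion_of_not_touch hnt)] at h1
    omega
  · exact fun M₁ h₁ M₂ h₂ => h.family.disjoint M₁ (Finset.mem_of_mem_erase h₁) M₂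
      (Finset.mem_of_mem_erase h₂)
  · exact fun M₁ h₁ M₂ h₂ => h.family.touch M₁ (Finset.mem_of_mem_erase h₁) M₂
      (Finset.mem_of_mem_erase h₂)
  · exact fun M₁ h₁ => h.family.centered M₁ (Finset.mem_of_mem_erase h₁)
  · exact fun M₁ h₁ => h.bag_subset M₁ (Finset.mem_of_mem_erase h₁)
  · exact fun M₁ h₁ => h.bag_disjoint M₁ (Finset.mem_of_mem_erase h₁)
  · exact fun M₁ h₁ => h.bag_card M₁ (Finset.mem_of_mem_erase h₁)

lemma insert_bag (h : IsStage G T ρ δ W X n l s R A Z B 𝓜) (hρ : ∀ v, 0 ≤ ρ v) (hδ : 0 ≤ δ)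
    {P : Finset ι} (hP : P ⊆ B) (hPs : P.card ≤ s)
    (hPR : ∃ z ∈ P.biUnion T, ∀ u ∈ P.biUnion T, G.ReachWithin (P.biUnion T : Finset V) R z u)
    (hPt : ∀ M ∈ 𝓜, G.Touch (M.biUnion T : Finset V) (P.biUnion T : Finset V)) :
    IsStage G T ρ δ W X n l s R A Z (B \ P) (insert P 𝓜) := by
  refine ⟨Finset.sdiff_subset.trans h.subset, ?_, ?_, ?_, h.balanced, ⟨?_, ?_, ?_⟩, ?_, ?_, ?_⟩
  · intro x hx
    have := h.cover hx
    simp only [Finset.mem_union, Finset.mem_biUnion, Finset.mem_insert, id, Finset.mem_sdiff]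
      at this ⊢
    by_cases hxP : x ∈ P
    · exact Or.inr ⟨P, Or.inl rfl, hxP⟩
    · rcases this with ((h1 | h1) | h1) | ⟨M', h1, h2⟩
      · simp [h1]
      · simp [h1]
      · simp [h1, hxP]
      · exact Or.inr ⟨M', Or.inr h1, h2⟩
  · exact fun x hx y hy => h.not_touch x hx y (Finset.mem_sdiff.1 hy).1
  · have := clusterWeight_mono (T := T) hρ hδ (Finset.sdiff_subset : B \ P ⊆ B)
    have := h.cost
    linarith
  · intro M hM M' hM' hne
    rcases Finset.mem_insert.1 hM with rfl | h₁ <;> rcases Finset.mem_insert.1 hM' with rfl | h₂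
    · exact absurd rfl hne
    · exact ((h.bag_disjoint M' h₂).mono_right hP).symm
    · exact (h.bag_disjoint M h₁).mono_right hP
    · exact h.family.disjoint M h₁ M' h₂ hne
  · intro M hM M' hM' hne
    rcases Finset.mem_insert.1 hM with rfl | h₁ <;> rcases Finset.mem_insert.1 hM' with rfl | h₂
    · exact absurd rfl hne
    · exact (hPt M' h₂).symm
    · exact hPt M h₁
    · exact h.family.touch M h₁ M' h₂ hne
  · intro M hM
    rcases Finset.mem_insert.1 hM with rfl | hM
    exacts [hPR, h.family.centered M hM]
  · intro M hM
    rcases Finset.mem_insert.1 hM with rfl | hM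
    exacts [hP.trans h.subset, h.bag_subset M hM]
  · intro M hM
    rcases Finset.mem_insert.1 hM with rfl | hM
    exacts [Finset.disjoint_sdiff, (h.bag_disjoint M hM).mono_right Finset.sdiff_subset]
  · intro M hM
    rcases Finset.mem_insert.1 hM with rfl | hM
    exacts [hPs, h.bag_card M hM]

/-- A ball of clusters in `B` that fills at most half of `B` is moved to `A`, and the cheap layer
around it to `Z`.  The cost of the layer is charged to the ball that it surrounds. -/
lemma cut_ball (h : IsStage G T ρ δ W X n l s R A Z B 𝓜) [Fintype V] (hn : n = Fintype.card V)
    (hρ : ∀ v, 0 ≤ ρ v) (hδ : 0 ≤ δ) (hT : ∀ x ∈ B, (T x).Nonempty)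
    (hB : 2 * n < 3 * (B.biUnion T).card) {v : ι} (hv : v ∈ B) {j : ℕ}
    (hhalf : 2 * ((G.touchBall T B v (j + 1)).biUnion T).card ≤ (B.biUnion T).card)
    (hcheap : (l : ℝ) * ∑ v ∈ (G.touchBall T B v (j + 2) \
      G.touchBall T B v (j + 1)).biUnion T, ρ v ≤ clusterWeight T ρ δ (G.touchBall T B v j)) :
    IsStage G T ρ δ W X n l s R (A ∪ G.touchBall T B v (j + 1))
      (Z ∪ (G.touchBall T B v (j + 2) \ G.touchBall T B v (j + 1)))
      (B \ G.touchBall T B v (j + 2)) 𝓜 := by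
  have hmono := touchBall_mono (G := G) hv hT
  have hsep : ∀ i, ∀ x ∈ G.touchBall T B v i, ∀ y ∈ B \ G.touchBall T B v (i + 1),
      ¬ G.Touch (T x) (T y) := by
    intro i x hx y hy ht
    obtain ⟨hyB, hy⟩ := Finset.mem_sdiff.1 hy
    exact hy (mem_touchBall_succ.2 ⟨hyB, x, hx, ht.symm⟩)
  refine ⟨Finset.sdiff_subset.trans h.subset, ?_, ?_, ?_, ?_, h.family, h.bag_subset,
    fun M hM => (h.bag_disjoint M hM).mono_right Finset.sdiff_subset, h.bag_card⟩
  · intro x hx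
    have := h.cover hx
    simp only [Finset.mem_union, Finset.mem_sdiff] at this ⊢
    tauto
  · intro x hx y hy
    rcases Finset.mem_union.1 hx with hx | hx
    · exact h.not_touch x hx y (Finset.mem_sdiff.1 hy).1
    · exact hsep _ x hx y hy
  · have h1 : clusterWeight T ρ δ (G.touchBall T B v j) +
        clusterWeight T ρ δ (B \ G.touchBall T B v (j + 2)) ≤ clusterWeight T ρ δ B := by
      refine clusterWeight_add_le (G := G) hρ hδ ?_ ?_ (touchBall_subset hv j) Finset.sdiff_subset
      · exact Finset.disjoint_sdiff.mono_left (hmono (by omega))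
      · exact fun x hx => hsep (j + 1) x (hmono (Nat.le_succ j) hx)
    have h2 := h.cost
    set L := G.touchBall T B v (j + 2) \ G.touchBall T B v (j + 1)
    have h3 : ∑ v ∈ (Z ∪ L).biUnion T, ρ v ≤
        ∑ v ∈ Z.biUnion T, ρ v + ∑ v ∈ L.biUnion T, ρ v := by
      rw [Finset.union_biUnion, ← Finset.sum_union_inter]
      have : 0 ≤ ∑ v ∈ Z.biUnion T ∩ L.biUnion T, ρ v := Finset.sum_nonneg fun v _ => hρ v
      linarith
    have h4 := mul_le_mul_of_nonneg_left h3 (Nat.cast_nonneg (α := ℝ) l)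
    rw [mul_add] at h4
    linarith
  · have h1 := Finset.card_le_univ (A.biUnion T ∪ B.biUnion T)
    rw [Finset.card_union_of_disjoint (disjoint_biUnion_of_not_touch h.not_touch)] at h1
    rw [Finset.union_biUnion]
    have h2 := Finset.card_union_le (A.biUnion T) ((G.touchBall T B v (j + 1)).biUnion T)
    omega

/-- As long as `B` is large, one of the three moves applies and makes progress.  A cheap layer is
found within radius `2 * (l * κ) + 2`; if two balls of radius `2 * (l * κ) + 1` touch, then their
centres are at distance at most `4 * (l * κ) + 3`, which is where this radius comes from. -/
lemma exists_next (h : IsStage G T ρ δ W X n l (s * (4 * (l * κ) + 4) + 1)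
      ((4 * (l * κ) + 3) * (2 * r + 1) + r) A Z B 𝓜) [Fintype V] (hn : n = Fintype.card V)
    (hρ : ∀ v, 0 ≤ ρ v) (hδ : 0 ≤ δ) (hl : 1 ≤ l) (hW : W < 2 ^ κ * δ) {ctr : ι → V}
    (hctr : ∀ x ∈ X, ctr x ∈ T x) (hT : ∀ x ∈ X, ∀ u ∈ T x, G.ReachWithin (T x) r (ctr x) u)
    (hs : 𝓜.card ≤ s) (hB : 2 * n < 3 * (B.biUnion T).card) :
    ∃ A' Z' B' 𝓜', IsStage G T ρ δ W X n l (s * (4 * (l * κ) + 4) + 1)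
      ((4 * (l * κ) + 3) * (2 * r + 1) + r) A' Z' B' 𝓜' ∧
        2 * B'.card + 𝓜'.card < 2 * B.card + 𝓜.card := by
  by_cases hiso : ∃ M ∈ 𝓜, ∀ x ∈ M, ∀ y ∈ B, ¬ G.Touch (T x) (T y)
  · obtain ⟨M, hM, hMB⟩ := hiso
    refine ⟨_, _, _, _, h.erase_bag hn hB hM hMB, ?_⟩
    have := Finset.card_erase_lt_of_mem hM
    omega
  push Not at hiso
  obtain ⟨v, hv⟩ : B.Nonempty := by
    rw [Finset.nonempty_iff_ne_empty]
    rintro rfl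
    simp at hB
  have : Nonempty ι := ⟨v⟩
  choose! a ha b hb hab using hiso
  have hctrB : ∀ x ∈ B, ctr x ∈ T x := fun x hx => hctr x (h.subset hx)
  have hne : ∀ x ∈ B, (T x).Nonempty := fun x hx => ⟨_, hctrB x hx⟩
  have hTB : ∀ x ∈ B, ∀ u ∈ T x, G.ReachWithin (T x) r (ctr x) u := fun x hx => hT x (h.subset hx)
  -- either a ball around `v` misses a neighbour `b M` of some bag, or chains of clusters from `v` to
  -- all `b M` form a new bag
  by_cases hfar : ∃ M ∈ 𝓜, b M ∉ G.touchBall T B v (4 * (l * κ) + 3)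
  · obtain ⟨M, hM, hMv⟩ := hfar
    set w := b M
    have hw : w ∈ B := hb M hM
    have hdisj : Disjoint ((G.touchBall T B v (2 * (l * κ) + 1)).biUnion T)
        ((G.touchBall T B w (2 * (l * κ) + 1)).biUnion T) := by
      refine disjoint_biUnion_of_not_touch (G := G) fun x hx y hy ht => hMv ?_
      have h1 : y ∈ G.touchBall T B v (2 * (l * κ) + 1 + 1) :=
        mem_touchBall_succ.2 ⟨touchBall_subset hw _ hy, x, hx, ht.symm⟩
      have := mem_touchBall_add hw hy h1
      rwa [show 2 * (l * κ) + 1 + 1 + (2 * (l * κ) + 1) = 4 * (l * κ) + 3 by ring] at this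
    have hBsub : ∀ u ∈ B, (G.touchBall T B u (2 * (l * κ) + 1)).biUnion T ⊆ B.biUnion T :=
      fun u hu => Finset.biUnion_subset_biUnion_of_subset_left _ (touchBall_subset hu _)
    have hsum := Finset.card_le_card (Finset.union_subset (hBsub v hv) (hBsub w hw))
    rw [Finset.card_union_of_disjoint hdisj] at hsum
    -- the smaller of the two disjoint balls
    obtain ⟨u, hu, hhalf⟩ : ∃ u ∈ B, 2 * ((G.touchBall T B u (2 * (l * κ) + 1)).biUnion T).card ≤
        (B.biUnion T).card := by
      rcases le_total ((G.touchBall T B v (2 * (l * κ) + 1)).biUnion T).card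
        ((G.touchBall T B w (2 * (l * κ) + 1)).biUnion T).card with h1 | h1
      exacts [⟨v, hv, by omega⟩, ⟨w, hw, by omega⟩]
    have hBW : clusterWeight T ρ δ B < 2 ^ κ * δ := by
      have h1 := h.cost
      have h2 : 0 ≤ (l : ℝ) * ∑ v ∈ Z.biUnion T, ρ v :=
        mul_nonneg (Nat.cast_nonneg l) (Finset.sum_nonneg fun v _ => hρ v)
      linarith
    obtain ⟨j, hj, hcheap⟩ := exists_cheap_layer (G := G) hu hne hρ hδ hl hBW
    have hmono := touchBall_mono (G := G) hu hne
    refine ⟨_, _, _, _, h.cut_ball hn hρ hδ hne hB hu (le_trans ?_ hhalf) hcheap, ?_⟩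
    · gcongr
      exact hmono (by omega)
    · have h1 : u ∈ G.touchBall T B u (j + 2) := hmono (Nat.zero_le _) (by simp [touchBall])
      have h2 : (B \ G.touchBall T B u (j + 2)).card < B.card :=
        Finset.card_lt_card (Finset.ssubset_iff_subset_ne.2 ⟨Finset.sdiff_subset, fun he => by
          rw [← he] at hu
          exact (Finset.mem_sdiff.1 hu).2 h1⟩)
      omega
  · push Not at hfar
    have hchain := fun M hM => exists_chain hTB hv _ (b M) (hfar M hM)
    choose! P hPB hvP hbP hPc hPR using hchain
    set Q : Finset ι := insert v (𝓜.biUnion P) with hQ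
    have hPQ : ∀ M ∈ 𝓜, P M ⊆ Q := fun M hM =>
      (Finset.subset_biUnion_of_mem P hM).trans (Finset.subset_insert _ _)
    have hQB : Q ⊆ B := Finset.insert_subset hv (Finset.biUnion_subset.2 hPB)
    have hvQ : v ∈ Q := Finset.mem_insert_self _ _
    refine ⟨_, _, _, _, h.insert_bag hρ hδ (P := Q) hQB ?_ ⟨ctr v, Finset.mem_biUnion.2
      ⟨v, hvQ, hctrB v hv⟩, ?_⟩ ?_, ?_⟩
    · refine (Finset.card_insert_le _ _).trans (Nat.succ_le_succ ?_)
      exact (Finset.card_biUnion_le_card_mul _ _ _ hPc).trans (Nat.mul_le_mul_right _ hs)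
    · intro u hu
      rw [hQ, Finset.biUnion_insert, Finset.mem_union, Finset.biUnion_biUnion,
        Finset.mem_biUnion] at hu
      rcases hu with hu | ⟨M, hM, hu⟩
      · refine (hTB v hv u hu).mono ?_ (Nat.le_add_left _ _)
        exact_mod_cast Finset.subset_biUnion_of_mem T hvQ
      · refine (hPR M hM u hu).mono ?_ le_rfl
        exact_mod_cast Finset.biUnion_subset_biUnion_of_subset_left T (hPQ M hM)
    · intro M hM
      refine (hab M hM).mono ?_ ?_
      · exact_mod_cast Finset.subset_biUnion_of_mem T (ha M hM)
      · exact_mod_cast Finset.subset_biUnion_of_mem T (hPQ M hM (hbP M hM))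
    · have h1 : (B \ Q).card < B.card :=
        Finset.card_lt_card (Finset.ssubset_iff_subset_ne.2 ⟨Finset.sdiff_subset, fun he => by
          rw [← he] at hv
          exact (Finset.mem_sdiff.1 hv).2 hvQ⟩)
      have h2 := Finset.card_insert_le Q 𝓜
      omega

end IsStage

/-- A system of clusters of radius `r` without large families of touching bags is split into two
parts `A` and `B` of bounded size by a set `Z` of clusters with small total cost and a bounded
number of further clusters `M`. -/
theorem exists_cluster_separation [Fintype V] (X : Finset ι) {ctr : ι → V} {r : ℕ}
    (hctr : ∀ x ∈ X, ctr x ∈ T x) (hT : ∀ x ∈ X, ∀ u ∈ T x, G.ReachWithin (T x) r (ctr x) u)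
    {ρ : V → ℝ} (hρ : ∀ v, 0 ≤ ρ v) (hρ0 : 0 < ∑ v, ρ v) {l κ s : ℕ} (hl : 1 ≤ l)
    (hκ : 2 * X.card < 2 ^ κ)
    (hs : ∀ 𝓜, G.IsBagFamily T ((4 * (l * κ) + 3) * (2 * r + 1) + r) 𝓜 → (∀ M ∈ 𝓜, M ⊆ X) →
      𝓜.card ≤ s) :
    ∃ A Z B M : Finset ι, X ⊆ A ∪ Z ∪ B ∪ M ∧ (∀ x ∈ A, ∀ y ∈ B, ¬ G.Touch (T x) (T y)) ∧
      l * ∑ v ∈ Z.biUnion T, ρ v ≤ 2 * ∑ v, ρ v ∧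
      3 * (A.biUnion T).card ≤ 2 * Fintype.card V ∧ 3 * (B.biUnion T).card ≤ 2 * Fintype.card V ∧
      M.card ≤ s * (s * (4 * (l * κ) + 4) + 1) := by
  rcases X.eq_empty_or_nonempty with rfl | hX
  · exact ⟨∅, ∅, ∅, ∅, by simp, by simp, by simpa using hρ0.le, by simp, by simp, by simp⟩
  have hXpos : (0 : ℝ) < X.card := by exact_mod_cast hX.card_pos
  set W := ∑ v, ρ v with hWdef
  set δ := W / X.card with hδdef
  have hδ : 0 < δ := by positivity
  have hsumle : ∀ Y : Finset ι, ∑ v ∈ Y.biUnion T, ρ v ≤ W := fun Y =>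
    Finset.sum_le_univ_sum_of_nonneg hρ
  have hW : 2 * W < 2 ^ κ * δ := by
    have h1 : (2 * X.card : ℝ) < 2 ^ κ := by exact_mod_cast hκ
    calc 2 * W = 2 * X.card * δ := by rw [hδdef]; field_simp
      _ < 2 ^ κ * δ := by gcongr
  have hfinish : ∀ k A Z B 𝓜, 2 * B.card + 𝓜.card = k →
      IsStage G T ρ δ (2 * W) X (Fintype.card V) l (s * (4 * (l * κ) + 4) + 1)
        ((4 * (l * κ) + 3) * (2 * r + 1) + r) A Z B 𝓜 →
      ∃ A Z B 𝓜, IsStage G T ρ δ (2 * W) X (Fintype.card V) l (s * (4 * (l * κ) + 4) + 1)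
        ((4 * (l * κ) + 3) * (2 * r + 1) + r) A Z B 𝓜 ∧
        3 * (B.biUnion T).card ≤ 2 * Fintype.card V := by
    intro k
    induction k using Nat.strong_induction_on with
    | _ k ih =>
      intro A Z B 𝓜 hk hst
      by_cases hB : 2 * Fintype.card V < 3 * (B.biUnion T).card
      · obtain ⟨A', Z', B', 𝓜', hst', hlt⟩ := hst.exists_next rfl hρ hδ.le hl hW hctr hT
          (hs 𝓜 hst.family hst.bag_subset) hB
        exact ih _ (by omega) A' Z' B' 𝓜' rfl hst'
      · exact ⟨A, Z, B, 𝓜, hst, by omega⟩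
  obtain ⟨A, Z, B, 𝓜, hst, hB⟩ := hfinish _ ∅ ∅ X ∅ rfl
    ⟨subset_rfl, by simp, by simp, by
      have h1 : (X.card : ℝ) * δ = W := by rw [hδdef]; field_simp
      have h2 := hsumle X
      simp only [clusterWeight, Finset.biUnion_empty, Finset.sum_empty, mul_zero, zero_add, h1]
      linarith, by simp, ⟨by simp, by simp, by simp⟩, by simp, by simp, by simp⟩
  refine ⟨A, Z, B, 𝓜.biUnion id, hst.cover, hst.not_touch, ?_, hst.balanced, hB, ?_⟩
  · have h1 := hst.cost
    have h2 : 0 ≤ clusterWeight T ρ δ B := by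
      refine le_trans ?_ (sum_biUnion_le_clusterWeight hδ.le B)
      exact Finset.sum_nonneg fun v _ => hρ v
    linarith
  · refine (Finset.card_biUnion_le_card_mul _ _ _ hst.bag_card).trans ?_
    exact Nat.mul_le_mul_right _ (hs 𝓜 hst.family hst.bag_subset)

end Clusters

/-! ### Weak reachability clusters and the reduction of the outliers -/

section Outliers

variable {V : Type*} {G : SimpleGraph V}

lemma ReachWithin.mem_of_closed {U Q : Set V} {R : ℕ} {v u : V} (h : G.ReachWithin U R v u)
    (hv : v ∈ Q) (hQ : ∀ x ∈ Q, x ∈ U → ∀ y ∈ U, G.Adj x y → y ∈ Q) : u ∈ Q := by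
  obtain ⟨P, -, hP⟩ := h
  induction P with
  | nil => exact hv
  | @cons a b c hab P ih =>
    have hP' : ∀ x ∈ P.support, x ∈ U := fun x hx => hP x (by simp [hx])
    exact ih (hQ a hv (hP a (by simp)) b (hP' b P.start_mem_support) hab) hP'

lemma image_supp_connectedComponentMk {U : Set V} (v : U) :
    Subtype.val '' ((G.induce U).connectedComponentMk v).supp =
      {u | ∃ R, G.ReachWithin U R v u} := by
  ext u
  constructor
  · rintro ⟨w, hw, rfl⟩
    obtain ⟨P⟩ := (ConnectedComponent.exact hw).symm
    refine ⟨_, P.map (Embedding.induce U).toHom, le_rfl, fun x hx => ?_⟩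
    obtain ⟨y, -, rfl⟩ := List.mem_map.1 ((Walk.support_map _ P) ▸ hx)
    exact y.2
  · rintro ⟨R, P, -, hP⟩
    exact ⟨⟨u, hP u P.end_mem_support⟩, ConnectedComponent.sound ⟨(P.induce U hP).reverse⟩, rfl⟩

lemma isBalancedSeparator_iff [Fintype V] (C : Finset V) : G.IsBalancedSeparator C ↔
    ∀ v ∉ C, 3 * {u | ∃ R, G.ReachWithin ((C : Set V)ᶜ) R v u}.ncard ≤ 2 * Fintype.card V := by
  have key : ∀ v : ((C : Set V)ᶜ : Set V),
      ((G.induce ((C : Set V)ᶜ)).connectedComponentMk v).supp.ncard =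
        {u | ∃ R, G.ReachWithin ((C : Set V)ᶜ) R v u}.ncard := fun v => by
    rw [← image_supp_connectedComponentMk, Set.ncard_image_of_injective _ Subtype.val_injective]
  have arith : ∀ a : ℕ, (a : ℝ) ≤ 2 / 3 * (Fintype.card V : ℝ) ↔ 3 * a ≤ 2 * Fintype.card V := by
    intro a
    rw [← Nat.cast_le (α := ℝ)]
    push_cast
    constructor <;> intro h <;> linarith
  constructor
  · intro h v hv
    have := h ((G.induce ((C : Set V)ᶜ)).connectedComponentMk ⟨v, by simpa using hv⟩)
    rwa [key, arith] at this
  · intro h K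
    induction K using ConnectedComponent.ind with
    | _ v =>
      rw [key, arith]
      exact h v v.2

/-- The vertices from which `x` is weakly reachable form a set of radius at most `r` around `x`. -/
lemma reachWithin_of_mem_weakReach {o : LinearOrder V} {r : ℕ} {x u : V}
    (h : x ∈ G.weakReach o r u) : G.ReachWithin {w | x ∈ G.weakReach o r w} r x u := by
  obtain ⟨P, hP, hl, hx⟩ := h
  refine ReachWithin.symm ⟨P, hl, fun w hw => ⟨P.dropUntil w hw, hP.dropUntil hw, ?_, ?_⟩⟩
  · exact (P.length_dropUntil_le_length hw).trans hl
  · exact fun y hy => hx y (P.support_dropUntil_subset_support hw hy)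

lemma exists_mem_weakReach_of_walk (o : LinearOrder V) {r : ℕ} {s v : V} (P : G.Walk s v)
    (hP : P.length ≤ r) : ∃ y ∈ P.support, y ∈ G.weakReach o r s ∧ y ∈ G.weakReach o r v := by
  classical
  obtain ⟨y, hy, hmin⟩ := Finset.exists_min_image P.support.toFinset id ⟨s, by simp⟩
  rw [List.mem_toFinset] at hy
  have hmin' : ∀ x ∈ P.support, o.le y x := fun x hx => hmin x (by simpa using hx)
  refine ⟨y, hy, ⟨(P.takeUntil y hy).bypass, Walk.bypass_isPath _, ?_, fun x hx => hmin' x ?_⟩,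
    ⟨(P.dropUntil y hy).reverse.bypass, Walk.bypass_isPath _, ?_, fun x hx => hmin' x ?_⟩⟩
  · exact ((Walk.length_bypass_le_length _).trans (P.length_takeUntil_le_length hy)).trans hP
  · exact P.support_takeUntil_subset_support hy (Walk.support_bypass_subset_support _ hx)
  · refine ((Walk.length_bypass_le_length _).trans ?_).trans hP
    rw [Walk.length_reverse]
    exact P.length_dropUntil_le_length hy
  · have := Walk.support_bypass_subset_support _ hx
    rw [Walk.support_reverse, List.mem_reverse] at this
    exact P.support_dropUntil_subset_support hy this

lemma exists_wcolOrder_eq_wcol [Fintype V] (r : ℕ) :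
    ∃ o : LinearOrder V, G.wcolOrder o r = G.wcol r := by
  classical
  have : Nonempty (LinearOrder V) := ⟨linearOrderOfSTO (WellOrderingRel (α := V))⟩
  exact ciInf_mem fun o : LinearOrder V => G.wcolOrder o r

lemma exists_small_increment (f : ℕ → ℝ) {r : ℕ} (hr : 1 ≤ r) {W : ℝ} (h0 : 0 ≤ f 0)
    (hW : f r ≤ W) : ∃ i < r, r * (f (i + 1) - f i) ≤ W := by
  by_contra! h
  have h1 := Finset.sum_lt_sum_of_nonempty (s := Finset.range r) (by simp; omega)
    fun i hi => h i (Finset.mem_range.1 hi)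
  rw [← Finset.mul_sum, Finset.sum_range_sub, Finset.sum_const, Finset.card_range, nsmul_eq_mul]
    at h1
  have := lt_of_mul_lt_mul_left h1 (Nat.cast_nonneg r)
  linarith

/-- Suppose that all expensive vertices of a balanced separator `C₀` lie in a small set `S`.  The
vertices within distance `r` of `S` are covered by the clusters of the few vertices weakly reachable
from `S`, and `G` has a balanced separator whose number of outliers depends on `n` only through the
logarithm `κ` of the number of these clusters: it consists of a separator of the clusters, of a cheap set of vertices at some
fixed distance from `S`, and of `C₀ \ S`, which separates the part of the graph far from `S`. -/
theorem IsBalancedSeparator.exists_few_outliers [Fintype V] [DecidableEq V] {C₀ S : Finset V}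
    (hC₀ : G.IsBalancedSeparator C₀) {ρ : V → ℝ} (hρ : ∀ v, 0 ≤ ρ v) (hρ0 : 0 < ∑ v, ρ v)
    {r l κ d R s : ℕ} (hr : 1 ≤ r) (hl : 1 ≤ l) (hκ : 2 * (S.card * G.wcol r) < 2 ^ κ)
    (hR : R = (4 * (l * κ) + 3) * (2 * r + 1) + r) (hd : G.nabla R ≤ d)
    (hs : s = (2 * R + 2) * G.wcol r * (2 * d + 3) ^ 3 + 2 * d + 5) :
    ∃ C C' : Finset V, G.IsBalancedSeparator C ∧ C' ⊆ C ∧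
      C'.card ≤ s * (s * (4 * (l * κ) + 4) + 1) ∧
      ∑ v ∈ C \ C', ρ v ≤ ∑ v ∈ C₀ \ S, ρ v + 2 * (∑ v, ρ v) / l + (∑ v, ρ v) / r := by
  classical
  obtain ⟨o, ho⟩ := G.exists_wcolOrder_eq_wcol r
  have hwr : ∀ v, (G.weakReach o r v).ncard ≤ G.wcol r := fun v => by
    rw [← ho]
    exact Finset.le_sup (f := fun v => (G.weakReach o r v).ncard) (Finset.mem_univ v)
  let T : V → Finset V := fun x => Finset.univ.filter fun u => x ∈ G.weakReach o r u
  have hTmem : ∀ x u, u ∈ T x ↔ x ∈ G.weakReach o r u := fun x u => by simp [T]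
  have hTset : ∀ x, ((T x : Finset V) : Set V) = {w | x ∈ G.weakReach o r w} := fun x => by
    ext u; simp [hTmem]
  have hself : ∀ x, x ∈ T x := fun x => by
    rw [hTmem]
    exact ⟨Walk.nil, Walk.IsPath.nil, by simp, by simp⟩
  let X : Finset V := S.biUnion fun v => (G.weakReach o r v).toFinset
  have hXcard : X.card ≤ S.card * G.wcol r := by
    refine Finset.card_biUnion_le_card_mul _ _ _ fun v _ => ?_
    rw [← Set.ncard_eq_toFinset_card']
    exact hwr v
  have hmult : ∀ v, (X.filter fun x => v ∈ T x).card ≤ G.wcol r := by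
    intro v
    refine le_trans ?_ (hwr v)
    rw [← Set.ncard_coe_finset]
    refine Set.ncard_le_ncard (fun x hx => ?_) (Set.toFinite _)
    simpa [hTmem] using (Finset.mem_filter.1 (Finset.mem_coe.1 hx)).2
  obtain ⟨A, Z, B, M, hcover, hnt, hZ, hA, hB, hM⟩ := exists_cluster_separation (G := G) (T := T) X
    (ctr := id) (r := r) (fun x _ => hself x) (fun x _ u hu => by
      rw [hTset]; exact reachWithin_of_mem_weakReach ((hTmem x u).1 hu)) hρ hρ0 hl
    (κ := κ) (s := s) (by omega) (fun 𝓜 h𝓜 hX => by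
      rw [← hR] at h𝓜
      rw [hs]
      exact h𝓜.card_le hX hmult hd)
  -- the vertices at distance at most `i` from `S` after the deletion of `M`
  let D : ℕ → Finset V := fun i =>
    Finset.univ.filter fun v => ∃ x ∈ S, G.ReachWithin ((M : Set V)ᶜ) i x v
  have hDmem : ∀ i v, v ∈ D i ↔ ∃ x ∈ S, G.ReachWithin ((M : Set V)ᶜ) i x v := fun i v => by
    simp [D]
  have hDmono : ∀ i j, i ≤ j → D i ⊆ D j := fun i j hij v hv => by
    rw [hDmem] at hv ⊢
    obtain ⟨x, hx, h⟩ := hv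
    exact ⟨x, hx, h.mono subset_rfl hij⟩
  obtain ⟨i, hir, hi⟩ := exists_small_increment (fun i => ∑ v ∈ D i, ρ v) hr
    (Finset.sum_nonneg fun v _ => hρ v)
    (Finset.sum_le_univ_sum_of_nonneg hρ : ∑ v ∈ D r, ρ v ≤ ∑ v, ρ v)
  set L := D (i + 1) \ D i with hLdef
  set C := (C₀ \ S) ∪ M ∪ Z.biUnion T ∪ L with hCdef
  have hCmem : ∀ {v}, v ∉ C → (v ∈ C₀ → v ∈ S) ∧ v ∉ M ∧ v ∉ Z.biUnion T ∧
      (v ∈ D (i + 1) → v ∈ D i) := by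
    intro v hv
    simp only [hCdef, hLdef, Finset.mem_union, Finset.mem_sdiff, not_or, not_and, not_not] at hv
    exact ⟨hv.1.1.1, hv.1.1.2, hv.1.2, hv.2⟩
  have hDadj : ∀ u ∈ D i, ∀ v, v ∉ C → G.Adj u v → v ∈ D i := by
    intro u hu v hv huv
    obtain ⟨-, hvM, -, hvD⟩ := hCmem hv
    refine hvD ?_
    rw [hDmem] at hu ⊢
    obtain ⟨x, hx, h⟩ := hu
    exact ⟨x, hx, h.trans (ReachWithin.of_adj h.mem_right (by simpa using hvM) (Or.inr huv))⟩
  -- the least vertex of a path from `S` to `v` that avoids `M` is the centre of a cluster containing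
  -- `v`, and this centre is neither in `M` nor, as `v` is not deleted, in `Z`
  have hDAB : ∀ v ∈ D i, v ∉ C → v ∈ A.biUnion T ∨ v ∈ B.biUnion T := by
    intro v hv hvC
    obtain ⟨-, -, hvZ, -⟩ := hCmem hvC
    obtain ⟨x, hx, P, hP, hPM⟩ := (hDmem i v).1 hv
    obtain ⟨y, hyP, hyx, hyv⟩ := exists_mem_weakReach_of_walk o P (hP.trans hir.le)
    have hyX : y ∈ X := Finset.mem_biUnion.2 ⟨x, hx, by simpa using hyx⟩
    have hvy : v ∈ T y := (hTmem y v).2 hyv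
    have hyM : y ∉ M := by simpa using hPM y hyP
    have hyZ : y ∉ Z := fun h => hvZ (Finset.mem_biUnion.2 ⟨y, h, hvy⟩)
    have := hcover hyX
    simp only [Finset.mem_union] at this
    rcases this with ((h | h) | h) | h
    · exact Or.inl (Finset.mem_biUnion.2 ⟨y, h, hvy⟩)
    · exact absurd h hyZ
    · exact Or.inr (Finset.mem_biUnion.2 ⟨y, h, hvy⟩)
    · exact absurd h hyM
  have hABadj : ∀ u ∈ A.biUnion T, ∀ v ∈ B.biUnion T, ¬ G.Adj u v := by
    intro u hu v hv huv
    obtain ⟨x, hx, hux⟩ := Finset.mem_biUnion.1 hu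
    obtain ⟨y, hy, hvy⟩ := Finset.mem_biUnion.1 hv
    exact hnt x hx y hy ⟨u, hux, v, hvy, Or.inr huv⟩
  refine ⟨C, M, ?_, ?_, hM, ?_⟩
  · rw [isBalancedSeparator_iff] at hC₀ ⊢
    intro v hv
    have hbound : ∀ Y : Finset V, 3 * Y.card ≤ 2 * Fintype.card V →
        {u | ∃ R, G.ReachWithin ((C : Set V)ᶜ) R v u} ⊆ Y →
        3 * {u | ∃ R, G.ReachWithin ((C : Set V)ᶜ) R v u}.ncard ≤ 2 * Fintype.card V := by
      intro Y hY hsub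
      have := Set.ncard_le_ncard hsub (Set.toFinite _)
      rw [Set.ncard_coe_finset] at this
      omega
    by_cases hvD : v ∈ D i
    · rcases hDAB v hvD hv with hvA | hvB
      · refine hbound _ hA ?_
        rintro u ⟨R', hu⟩
        refine (hu.mem_of_closed (Q := {w | w ∈ D i ∧ w ∈ A.biUnion T}) ⟨hvD, hvA⟩ ?_).2
        rintro x ⟨hxD, hxA⟩ - y hy hxy
        have hyC : y ∉ C := by simpa using hy
        have hyD := hDadj x hxD y hyC hxy
        exact ⟨hyD, (hDAB y hyD hyC).resolve_right fun h => hABadj x hxA y h hxy⟩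
      · refine hbound _ hB ?_
        rintro u ⟨R', hu⟩
        refine (hu.mem_of_closed (Q := {w | w ∈ D i ∧ w ∈ B.biUnion T}) ⟨hvD, hvB⟩ ?_).2
        rintro x ⟨hxD, hxB⟩ - y hy hxy
        have hyC : y ∉ C := by simpa using hy
        have hyD := hDadj x hxD y hyC hxy
        exact ⟨hyD, (hDAB y hyD hyC).resolve_left fun h => hABadj y h x hxB hxy.symm⟩
    · -- the component of `v` is disjoint from `S`, so `C₀` separates it as well as `C₀ \ S` does
      have hfar : ∀ w, w ∉ C → w ∉ D i → w ∉ C₀ := by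
        intro w hwC hwD hw
        obtain ⟨hwS, hwM, -, -⟩ := hCmem hwC
        exact hwD ((hDmem i w).2 ⟨w, hwS hw, ReachWithin.refl (by simpa using hwM)⟩)
      have hcomp : ∀ u R', G.ReachWithin ((C : Set V)ᶜ) R' v u → u ∉ D i := by
        intro u R' hu
        refine hu.mem_of_closed (Q := {w | w ∉ D i}) hvD ?_
        intro x hxD hx y _ hxy hyD
        exact hxD (hDadj y hyD x (by simpa using hx) hxy.symm)
      refine le_trans (Nat.mul_le_mul_left _ (Set.ncard_le_ncard ?_ (Set.toFinite _)))
        (hC₀ v (hfar v hv hvD))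
      rintro u ⟨R', P, hP, hPC⟩
      refine ⟨R', P, hP, fun w hw => ?_⟩
      have h1 : G.ReachWithin ((C : Set V)ᶜ) (P.takeUntil w hw).length v w :=
        ⟨P.takeUntil w hw, le_rfl, fun x hx =>
          hPC x (P.support_takeUntil_subset_support hw hx)⟩
      simpa using hfar w (by simpa using hPC w hw) (hcomp w _ h1)
  · intro x hx
    simp [hCdef, hx]
  · have hl0 : (0 : ℝ) < l := by exact_mod_cast hl
    have hr0 : (0 : ℝ) < r := by exact_mod_cast hr
    have h1 : ∑ v ∈ C \ M, ρ v ≤ ∑ v ∈ (C₀ \ S) ∪ Z.biUnion T ∪ L, ρ v := by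
      refine Finset.sum_le_sum_of_subset_of_nonneg (fun v hv => ?_) fun v _ _ => hρ v
      simp only [hCdef, Finset.mem_sdiff, Finset.mem_union] at hv ⊢
      tauto
    have hunion : ∀ Y Y' : Finset V, ∑ v ∈ Y ∪ Y', ρ v ≤ ∑ v ∈ Y, ρ v + ∑ v ∈ Y', ρ v := by
      intro Y Y'
      rw [← Finset.sum_union_inter]
      have : 0 ≤ ∑ v ∈ Y ∩ Y', ρ v := Finset.sum_nonneg fun v _ => hρ v
      linarith
    have h2 := hunion ((C₀ \ S) ∪ Z.biUnion T) L
    have h3 := hunion (C₀ \ S) (Z.biUnion T)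
    have h4 : ∑ v ∈ Z.biUnion T, ρ v ≤ 2 * (∑ v, ρ v) / l := by
      rw [le_div_iff₀ hl0, mul_comm]
      exact hZ
    have h5 : ∑ v ∈ L, ρ v ≤ (∑ v, ρ v) / r := by
      rw [le_div_iff₀ hr0, mul_comm, hLdef, Finset.sum_sdiff_eq_sub (hDmono i (i + 1) (by omega))]
      exact hi
    linarith

end Outliers

end SimpleGraph

/-! ### Growth estimates -/

section Growth

lemma IsPolynomialFun.exists_le {p : ℕ → ℕ} (hp : IsPolynomialFun p) :
    ∃ K e : ℕ, 1 ≤ K ∧ ∀ k, p k ≤ K * (k + 1) ^ e := by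
  obtain ⟨P, hP⟩ := hp
  refine ⟨⌈∑ i ∈ Finset.range (P.natDegree + 1), |P.coeff i|⌉₊ + 1, P.natDegree, by omega,
    fun k => ?_⟩
  have h1 : (p k : ℝ) ≤ (∑ i ∈ Finset.range (P.natDegree + 1), |P.coeff i|) *
      ((k : ℝ) + 1) ^ P.natDegree := by
    rw [hP, Polynomial.eval_eq_sum_range, Finset.sum_mul]
    refine Finset.sum_le_sum fun i hi => ?_
    have h2 : (k : ℝ) ^ i ≤ ((k : ℝ) + 1) ^ P.natDegree :=
      (pow_le_pow_left₀ (Nat.cast_nonneg k) (by linarith) i).trans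
        (pow_le_pow_right₀ (by simp) (Nat.lt_succ_iff.1 (Finset.mem_range.1 hi)))
    exact (mul_le_mul_of_nonneg_right (le_abs_self _) (by positivity)).trans
      (mul_le_mul_of_nonneg_left h2 (abs_nonneg _))
  have h2 : (∑ i ∈ Finset.range (P.natDegree + 1), |P.coeff i|) ≤
      (⌈∑ i ∈ Finset.range (P.natDegree + 1), |P.coeff i|⌉₊ + 1 : ℕ) := by
    push_cast
    exact (Nat.le_ceil _).trans (by linarith)
  have h3 := h1.trans (mul_le_mul_of_nonneg_right h2 (by positivity))
  exact_mod_cast h3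

lemma isPolynomialFun_const_mul_pow (K m : ℕ) : IsPolynomialFun fun t => K * t ^ m :=
  ⟨Polynomial.C (K : ℝ) * Polynomial.X ^ m, fun k => by simp⟩

lemma exists_one_add_logb_pow_le (f : ℕ) :
    ∃ F : ℝ, 0 ≤ F ∧ ∀ y : ℝ, 1 ≤ y → (1 + Real.logb 2 y) ^ f ≤ F * y := by
  have hl : 0 < Real.log 2 := Real.log_pos (by norm_num)
  refine ⟨2 * f.factorial / Real.log 2 ^ f, by positivity, fun y hy => ?_⟩
  have h1 : 1 + Real.logb 2 y = Real.log (2 * y) / Real.log 2 := by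
    rw [Real.log_mul (by norm_num) (by linarith), Real.logb]
    field_simp
  have h2 := Real.pow_div_factorial_le_exp (Real.log (2 * y)) (Real.log_nonneg (by linarith)) f
  rw [Real.exp_log (by linarith), div_le_iff₀ (by positivity)] at h2
  rw [h1, div_pow, div_mul_eq_mul_div]
  gcongr
  linarith

lemma iterLog_nonneg (a : ℕ) {x : ℝ} (hx : 0 ≤ x) : 0 ≤ iterLog a x := by
  cases a with
  | zero => exact hx
  | succ a => exact Real.logb_nonneg (by norm_num) (by simp)

lemma one_le_iterLog_succ (a : ℕ) (x : ℝ) : 1 ≤ iterLog (a + 1) x := by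
  rw [iterLog, Real.le_logb_iff_rpow_le (by norm_num) (by positivity)]
  simp

lemma one_le_iterLog (a : ℕ) {x : ℝ} (hx : 1 ≤ x) : 1 ≤ iterLog a x := by
  cases a with
  | zero => exact hx
  | succ a => exact one_le_iterLog_succ a x

lemma logb_iterLog_le (a : ℕ) {x : ℝ} (hx : 1 ≤ x) :
    Real.logb 2 (iterLog a x) ≤ iterLog (a + 1) x := by
  have := one_le_iterLog a hx
  exact Real.logb_le_logb_of_le (by norm_num) (by linarith) (le_max_right _ _)

lemma iterLog_succ_le (a : ℕ) {x : ℝ} (hx : 1 ≤ x) :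
    iterLog (a + 1) x ≤ 1 + Real.logb 2 (iterLog a x) := by
  have h := one_le_iterLog a hx
  rw [iterLog, ← Real.logb_self_eq_one (b := 2) (by norm_num),
    ← Real.logb_mul (by norm_num) (by linarith)]
  exact Real.logb_le_logb_of_le (by norm_num) (by positivity) (max_le (by linarith) (by linarith))

/-- The number of outliers produced by one reduction step is quadratic in the weak coloring number
`c` and polynomial in `t` and in the logarithmic parameter `κ`. -/
lemma exists_outlier_count_le {p : ℕ → ℕ} (hp : IsPolynomialFun p) :
    ∃ A f : ℕ, ∀ t κ c R s : ℕ, 1 ≤ t → 1 ≤ κ → 1 ≤ c →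
      R = (4 * (8 * t * κ) + 3) * (2 * (4 * t) + 1) + 4 * t →
      s = (2 * R + 2) * c * (2 * p R + 3) ^ 3 + 2 * p R + 5 →
      s * (s * (4 * (8 * t * κ) + 4) + 1) ≤ c ^ 2 * (A * (t ^ 2 * κ) ^ f) := by
  obtain ⟨K, e, hK, hKp⟩ := hp.exists_le
  refine ⟨37 * (80007 * (K * 320 ^ e) ^ 3) ^ 2, 2 * (1 + 3 * e) + 1, ?_⟩
  intro t κ c R s ht hκ hc hR hs
  set z := t ^ 2 * κ with hz
  have hz1 : 1 ≤ z := Nat.mul_pos (by positivity) hκ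
  have htκ : t * κ ≤ z := by rw [hz]; exact Nat.mul_le_mul_right _ (Nat.le_self_pow two_ne_zero t)
  have htz : t ≤ z := (Nat.le_mul_of_pos_right t hκ).trans htκ
  have ht2 : t * t ≤ z := by rw [hz, sq]; exact Nat.le_mul_of_pos_right _ hκ
  have hR1 : R + 1 ≤ 320 * z := by
    have h1 : R = 256 * z + 32 * (t * κ) + 28 * t + 3 := by rw [hR, hz]; ring
    omega
  set D := (K * 320 ^ e) * z ^ e with hD
  have hD1 : 1 ≤ D := Nat.mul_pos (Nat.mul_pos hK (by positivity)) (by positivity)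
  have hpD : p R ≤ D := by
    calc p R ≤ K * (R + 1) ^ e := hKp R
      _ ≤ K * (320 * z) ^ e := by gcongr
      _ = D := by rw [mul_pow, hD]; ring
  have hD3 : D ≤ D ^ 3 := Nat.le_self_pow three_ne_zero D
  set E := 80007 * z * D ^ 3 with hE
  have hsE : s ≤ c * E := by
    have h1 : (2 * R + 2) * c * (2 * p R + 3) ^ 3 ≤ (640 * z) * c * (5 * D) ^ 3 := by
      gcongr <;> omega
    have h2 : 2 * p R + 5 ≤ 7 * (c * (z * D ^ 3)) := by
      have h3 : D ^ 3 ≤ c * (z * D ^ 3) :=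
        (Nat.le_mul_of_pos_left _ hz1).trans (Nat.le_mul_of_pos_left _ hc)
      omega
    calc s ≤ (640 * z) * c * (5 * D) ^ 3 + 7 * (c * (z * D ^ 3)) := by omega
      _ = c * E := by rw [hE]; ring
  calc s * (s * (4 * (8 * t * κ) + 4) + 1) ≤ s * (s * (36 * z) + s * z) := by
        have h1 : 4 * (8 * t * κ) + 4 ≤ 36 * z := by
          have : 4 * (8 * t * κ) = 32 * (t * κ) := by ring
          omega
        have h2 : 1 ≤ s * z := Nat.mul_pos (by omega) hz1
        gcongr
    _ = s ^ 2 * (37 * z) := by ring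
    _ ≤ (c * E) ^ 2 * (37 * z) := by gcongr
    _ = _ := by rw [hE, hD]; ring

end Growth

namespace SimpleGraph

/-! ### Iterating the reduction -/

section Iteration

universe u

lemma wcol_mono {V : Type*} [Fintype V] (G : SimpleGraph V) : Monotone G.wcol := by
  intro r r' h
  obtain ⟨o, ho⟩ := G.exists_wcolOrder_eq_wcol r'
  rw [← ho]
  refine (Nat.sInf_le ⟨o, rfl⟩ : G.wcol r ≤ G.wcolOrder o r).trans ?_
  refine Finset.sup_mono_fun fun v _ => Set.ncard_le_ncard ?_ (Set.toFinite _)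
  rintro u ⟨P, hP, hl, hu⟩
  exact ⟨P, hP, hl.trans h, hu⟩

lemma one_le_wcol {V : Type*} [Fintype V] [Nonempty V] (G : SimpleGraph V) (r : ℕ) :
    1 ≤ G.wcol r := by
  obtain ⟨o, ho⟩ := G.exists_wcolOrder_eq_wcol r
  rw [← ho]
  obtain ⟨v⟩ := ‹Nonempty V›
  refine le_trans ?_ (Finset.le_sup (f := fun v => (G.weakReach o r v).ncard) (Finset.mem_univ v))
  exact (Set.ncard_pos (Set.toFinite _)).2 ⟨v, Walk.nil, Walk.IsPath.nil, by simp, by simp⟩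

lemma isBalancedSeparator_univ {V : Type*} [Fintype V] (G : SimpleGraph V) :
    G.IsBalancedSeparator Finset.univ :=
  (isBalancedSeparator_iff _).2 fun v hv => absurd (Finset.mem_univ v) hv

lemma isCheapWithOutliers_univ_of_sum_eq_zero {V : Type*} [Fintype V] [DecidableEq V] {ρ : V → ℝ}
    (h : ∑ v, ρ v = 0) (t : ℕ) {x : ℝ} (hx : 0 ≤ x) :
    IsCheapWithOutliers ρ t x Finset.univ :=
  ⟨∅, by simp, by simpa using hx, by simp [h]⟩

/-- Every graph whose expansion is bounded by `p` has, for all costs and all `t ≥ 1`, a balanced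
separator with at most `K t ^ m * wcol ^ 5 * (log^(a) n) ^ e` outliers. -/
def HasPolylogOutliers (p : ℕ → ℕ) (a K m e : ℕ) : Prop :=
  ∀ (V : Type u) [Fintype V] [DecidableEq V] (G : SimpleGraph V), G.ExpansionBoundedBy p →
    ∀ ρ : V → ℝ, (∀ v, 0 ≤ ρ v) → ∀ t : ℕ, 1 ≤ t → ∃ C : Finset V, G.IsBalancedSeparator C ∧
      IsCheapWithOutliers ρ t (((K * t ^ m : ℕ) : ℝ) * (G.wcol (K * t ^ m) : ℝ) ^ 5 *
        iterLog a (Fintype.card V : ℝ) ^ e) C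

lemma hasPolylogOutliers_zero (p : ℕ → ℕ) : HasPolylogOutliers.{u} p 0 1 0 1 := by
  intro V _ _ G _ ρ hρ t _
  refine ⟨Finset.univ, G.isBalancedSeparator_univ, Finset.univ, subset_rfl, ?_, ?_⟩
  · rcases isEmpty_or_nonempty V with hV | hV
    · simp [iterLog]
    · have h1 : (1 : ℝ) ≤ (G.wcol 1 : ℝ) ^ 5 := one_le_pow₀ (by exact_mod_cast G.one_le_wcol 1)
      have h2 : (0 : ℝ) ≤ Fintype.card V := Nat.cast_nonneg _
      simp only [Finset.card_univ, pow_zero, mul_one, Nat.cast_one, one_mul, iterLog, pow_one]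
      exact le_mul_of_one_le_left h2 h1
  · simp only [Finset.sdiff_self, Finset.sum_empty]
    exact div_nonneg (Finset.sum_nonneg fun v _ => hρ v) (Nat.cast_nonneg _)

/-- The vertices of cost more than `ρ(V) / (k N)` are few, and they contain all but a cheap part of
any set that is `(ρ / k)`-cheap with `N` outliers. -/
lemma exists_expensive_set {V : Type*} [Fintype V] [DecidableEq V] {ρ : V → ℝ}
    (hρ : ∀ v, 0 ≤ ρ v) (hρ0 : 0 < ∑ v, ρ v) {k N : ℕ} (hk : 1 ≤ k) (hN : 1 ≤ N) {C : Finset V}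
    (hC : IsCheapWithOutliers ρ k N C) :
    ∃ S : Finset V, S.card ≤ k * N ∧ ∑ v ∈ C \ S, ρ v ≤ 2 * (∑ v, ρ v) / k := by
  classical
  obtain ⟨C', hC', hcard, hcost⟩ := hC
  set W := ∑ v, ρ v with hW
  have hk0 : (0 : ℝ) < k := by exact_mod_cast hk
  have hN0 : (0 : ℝ) < N := by exact_mod_cast hN
  refine ⟨Finset.univ.filter fun v => W < ρ v * (k * N), ?_, ?_⟩
  · set S := Finset.univ.filter fun v => W < ρ v * (k * N) with hS
    have h1 : (S.card : ℝ) * W ≤ (k * N) * W := by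
      calc (S.card : ℝ) * W = ∑ v ∈ S, W := by simp
        _ ≤ ∑ v ∈ S, ρ v * (k * N) :=
          Finset.sum_le_sum fun v hv => (Finset.mem_filter.1 hv).2.le
        _ = (k * N) * ∑ v ∈ S, ρ v := by rw [← Finset.sum_mul, mul_comm]
        _ ≤ (k * N) * W := by
          gcongr
          exact Finset.sum_le_univ_sum_of_nonneg hρ
    have h2 := le_of_mul_le_mul_right h1 hρ0
    exact_mod_cast h2
  · set S := Finset.univ.filter fun v => W < ρ v * (k * N) with hS
    have h1 : ∑ v ∈ C \ S, ρ v ≤ ∑ v ∈ C \ C', ρ v + ∑ v ∈ C' \ S, ρ v := by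
      rw [← Finset.sum_union (Finset.disjoint_of_subset_right Finset.sdiff_subset
        Finset.sdiff_disjoint)]
      refine Finset.sum_le_sum_of_subset_of_nonneg (fun v hv => ?_) fun v _ _ => hρ v
      simp only [Finset.mem_sdiff, Finset.mem_union] at hv ⊢
      tauto
    have h2 : ∑ v ∈ C' \ S, ρ v ≤ W / k := by
      calc ∑ v ∈ C' \ S, ρ v ≤ ∑ v ∈ C' \ S, W / (k * N) := by
            refine Finset.sum_le_sum fun v hv => ?_
            rw [le_div_iff₀ (by positivity)]
            by_contra! hlt
            exact (Finset.mem_sdiff.1 hv).2 (by simpa [hS] using hlt)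
        _ = (C' \ S).card * (W / (k * N)) := by simp
        _ ≤ N * (W / (k * N)) := by
          gcongr
          exact (Finset.card_le_card Finset.sdiff_subset).trans (by exact_mod_cast hcard)
        _ = W / k := by field_simp
    have h3 : 2 * W / k = W / k + W / k := by ring
    linarith

lemma _root_.IsCheapWithOutliers.mono {V : Type*} [Fintype V] [DecidableEq V] {ρ : V → ℝ} {t : ℕ}
    {x y : ℝ} {C : Finset V} (h : IsCheapWithOutliers ρ t x C) (hxy : x ≤ y) :
    IsCheapWithOutliers ρ t y C := by
  obtain ⟨C', h1, h2, h3⟩ := h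
  exact ⟨C', h1, h2.trans hxy, h3⟩

/-- The exponent of `2` that exceeds the number of clusters is at most a constant times
`t * (1 + log c) * log x` if `c ^ 5 * x ^ e` bounds the number of outliers up to a polynomial
in `t`. -/
lemma exists_log_le (K m e : ℕ) (hK : 1 ≤ K) : ∃ B : ℝ, 0 ≤ B ∧ ∀ (t k : ℕ) (c x y : ℝ), 1 ≤ t →
    1 ≤ c → 1 ≤ x → 1 ≤ y → Real.logb 2 x ≤ y →
    (k : ℝ) ≤ 16 * t * (K * (4 * t) ^ m * c ^ 5 * x ^ e) * c →
    ((Nat.log 2 k + 1 : ℕ) : ℝ) ≤ B * (t * (1 + Real.logb 2 c) * y) := by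
  have h16 : (1 : ℝ) ≤ 16 * K * 4 ^ m := by
    have h1 : (1 : ℝ) ≤ K := by exact_mod_cast hK
    have h2 : (1 : ℝ) ≤ 4 ^ m := one_le_pow₀ (by norm_num)
    nlinarith
  have hb0 : 0 ≤ Real.logb 2 (16 * K * 4 ^ m) := Real.logb_nonneg (by norm_num) h16
  refine ⟨1 + Real.logb 2 (16 * K * 4 ^ m) + (m + 1) + 6 + e, by positivity, ?_⟩
  intro t k c x y ht hc hx hy hxy hk
  have ht1 : (1 : ℝ) ≤ t := by exact_mod_cast ht
  have hlc : 0 ≤ Real.logb 2 c := Real.logb_nonneg (by norm_num) hc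
  have hlt : Real.logb 2 t ≤ t := by
    rw [Real.logb_le_iff_le_rpow (by norm_num) (by linarith), Real.rpow_natCast]
    exact_mod_cast Nat.lt_two_pow_self.le
  have hprod : 16 * t * (K * (4 * t) ^ m * c ^ 5 * x ^ e) * c =
      (16 * K * 4 ^ m) * t ^ (m + 1) * c ^ 6 * x ^ e := by
    rw [mul_pow]; ring
  have h1 : Real.logb 2 ((16 * K * 4 ^ m) * t ^ (m + 1) * c ^ 6 * x ^ e) =
      Real.logb 2 (16 * K * 4 ^ m) + (m + 1) * Real.logb 2 t + 6 * Real.logb 2 c +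
        e * Real.logb 2 x := by
    have h0 : (0 : ℝ) < 16 * K * 4 ^ m := by linarith
    rw [Real.logb_mul (by positivity) (by positivity), Real.logb_mul (by positivity)
      (by positivity), Real.logb_mul h0.ne' (by positivity), Real.logb_pow, Real.logb_pow,
      Real.logb_pow]
    push_cast
    ring
  have h2 : (Nat.log 2 k : ℝ) ≤ Real.logb 2 ((16 * K * 4 ^ m) * t ^ (m + 1) * c ^ 6 * x ^ e) := by
    rcases Nat.eq_zero_or_pos k with rfl | hk0
    · rw [Nat.log_zero_right, Nat.cast_zero]
      refine Real.logb_nonneg (by norm_num) ?_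
      have := one_le_pow₀ ht1 (n := m + 1)
      have := one_le_pow₀ hc (n := 6)
      have := one_le_pow₀ hx (n := e)
      refine one_le_mul_of_one_le_of_one_le (one_le_mul_of_one_le_of_one_le
        (one_le_mul_of_one_le_of_one_le h16 ?_) ?_) ?_ <;> assumption
    · rw [← hprod]
      refine le_trans ?_ (Real.logb_le_logb_of_le (by norm_num) (by exact_mod_cast hk0) hk)
      rw [Real.le_logb_iff_rpow_le (by norm_num) (by exact_mod_cast hk0), Real.rpow_natCast]
      exact_mod_cast Nat.pow_log_le_self 2 hk0.ne'
  set P := t * (1 + Real.logb 2 c) * y with hP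
  have hty : (t : ℝ) ≤ t * (1 + Real.logb 2 c) := le_mul_of_one_le_right (by linarith) (by linarith)
  have hcy : 1 + Real.logb 2 c ≤ t * (1 + Real.logb 2 c) :=
    le_mul_of_one_le_left (by linarith) ht1
  have hP0 : t * (1 + Real.logb 2 c) ≤ P := le_mul_of_one_le_right (by linarith) hy
  have hyP : y ≤ P := le_mul_of_one_le_left (by linarith) (by linarith)
  have h3 : (m + 1 : ℝ) * Real.logb 2 t ≤ (m + 1) * P := by gcongr; linarith
  have h4 : 6 * Real.logb 2 c ≤ 6 * P := by linarith
  have h5 : (e : ℝ) * Real.logb 2 x ≤ e * P := by gcongr; linarith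
  have h6 : 1 + Real.logb 2 (16 * K * 4 ^ m) ≤ (1 + Real.logb 2 (16 * K * 4 ^ m)) * P :=
    le_mul_of_one_le_right (by linarith) (by linarith)
  push_cast
  linarith

/-- One reduction step replaces `log^(a) n` by a power of `log^(a + 1) n`. -/
lemma HasPolylogOutliers.succ {p : ℕ → ℕ} (hp : IsPolynomialFun p) {a K m e : ℕ} (hK : 1 ≤ K)
    (h : HasPolylogOutliers.{u} p a K m e) :
    ∃ K' m' e' : ℕ, 1 ≤ K' ∧ HasPolylogOutliers.{u} p (a + 1) K' m' e' := by
  obtain ⟨A, f, hA⟩ := exists_outlier_count_le hp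
  obtain ⟨F, hF0, hF⟩ := exists_one_add_logb_pow_le f
  obtain ⟨B, hB0, hB⟩ := exists_log_le K m e hK
  -- `K'` also makes `K' * t ^ m'` exceed both radii at which weak coloring numbers are taken
  -- `K'` also makes `K' * t ^ m'` exceed both radii at which weak coloring numbers are taken
  -- `K'` also makes `K' * t ^ m'` exceed both radii at which weak coloring numbers are taken
  set K' : ℕ := ⌈A * (B ^ f * F)⌉₊ + K * 4 ^ m + 4 with hK'
  refine ⟨K', 3 * f + m + 1, f, by omega, ?_⟩
  intro V _ _ G hG ρ hρ t ht
  have hlog0 : 0 ≤ iterLog (a + 1) (Fintype.card V : ℝ) := iterLog_nonneg _ (Nat.cast_nonneg _)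
  rcases (Finset.sum_nonneg fun v (_ : v ∈ Finset.univ) => hρ v).eq_or_lt with hρ0 | hρ0
  · exact ⟨Finset.univ, G.isBalancedSeparator_univ,
      isCheapWithOutliers_univ_of_sum_eq_zero hρ0.symm t (by positivity)⟩
  have hV : Nonempty V := by
    by_contra hV
    rw [not_nonempty_iff] at hV
    simp at hρ0
  set W := ∑ v, ρ v
  set q := K' * t ^ (3 * f + m + 1) with hq
  set c := G.wcol q with hc
  have hc1 : 1 ≤ c := G.one_le_wcol q
  set x := iterLog a (Fintype.card V : ℝ)
  set y := iterLog (a + 1) (Fintype.card V : ℝ)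
  have hn1 : (1 : ℝ) ≤ Fintype.card V := by exact_mod_cast Fintype.card_pos
  have hx1 : 1 ≤ x := one_le_iterLog a hn1
  have hy1 : 1 ≤ y := one_le_iterLog_succ a _
  have hq4 : 4 * t ≤ q := by
    rw [hq]
    exact Nat.mul_le_mul (by omega) (Nat.le_self_pow (by omega) t)
  have hqK : K * (4 * t) ^ m ≤ q := by
    rw [hq, mul_pow, ← mul_assoc]
    exact Nat.mul_le_mul (by omega) (Nat.pow_le_pow_right ht (by omega))
  -- The budget `W / t` is split: `W / (2 * t)` for the part of `C₀` outside the expensive vertices,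
  -- `W / (4 * t)` each for the separated clusters (`l = 8 * t`) and the layer (`r = 4 * t`).
  -- The budget `W / t` is split: `W / (2 * t)` for the part of `C₀` outside the expensive vertices,
  -- `W / (4 * t)` each for the separated clusters (`l = 8 * t`) and the layer (`r = 4 * t`).
  -- The budget `W / t` is split: `W / (2 * t)` for the part of `C₀` outside the expensive vertices,
  -- `W / (4 * t)` each for the separated clusters (`l = 8 * t`) and the layer (`r = 4 * t`).
  obtain ⟨C₀, hC₀, hcheap⟩ := h V G hG ρ hρ (4 * t) (by omega)
  set N₀ : ℝ := K * (4 * t) ^ m * (c : ℝ) ^ 5 * x ^ e with hN₀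
  have hN₀1 : 1 ≤ N₀ := by
    have h1 : (1 : ℝ) ≤ K := by exact_mod_cast hK
    have h2 : (1 : ℝ) ≤ (4 * t) ^ m := one_le_pow₀ (by exact_mod_cast (by omega : 1 ≤ 4 * t))
    have h3 : (1 : ℝ) ≤ (c : ℝ) ^ 5 := one_le_pow₀ (by exact_mod_cast hc1)
    have h4 : 1 ≤ x ^ e := one_le_pow₀ hx1
    exact one_le_mul_of_one_le_of_one_le (one_le_mul_of_one_le_of_one_le
      (one_le_mul_of_one_le_of_one_le h1 h2) h3) h4
  set N := ⌈N₀⌉₊ with hN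
  have hN1 : 1 ≤ N := Nat.one_le_ceil_iff.2 (by linarith)
  have hN2 : (N : ℝ) ≤ 2 * N₀ := by
    have := Nat.ceil_lt_add_one (by linarith : 0 ≤ N₀)
    linarith
  have hcheap' : IsCheapWithOutliers ρ (4 * t) N C₀ := by
    refine hcheap.mono (le_trans ?_ (Nat.le_ceil N₀))
    rw [hN₀]
    push_cast
    have : (G.wcol (K * (4 * t) ^ m) : ℝ) ≤ c := by exact_mod_cast G.wcol_mono hqK
    gcongr
  obtain ⟨S, hS, hSC⟩ := exists_expensive_set hρ hρ0 (by omega) hN1 hcheap'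
  set κ := Nat.log 2 (2 * (S.card * G.wcol (4 * t))) + 1 with hκ
  have hcw : G.wcol (4 * t) ≤ c := G.wcol_mono hq4
  obtain ⟨C, C', hC, hC'C, hC', hcost⟩ := hC₀.exists_few_outliers hρ hρ0 (r := 4 * t) (l := 8 * t)
    (κ := κ) (by omega) (by omega) (Nat.lt_pow_succ_log_self one_lt_two _) rfl (hG _) rfl
  refine ⟨C, hC, C', hC'C, ?_, ?_⟩
  · have h1 := hC'.trans (hA t κ (G.wcol (4 * t)) _ _ ht (by omega) (G.one_le_wcol _) rfl rfl)
    have hκB : (κ : ℝ) ≤ B * (t * (1 + Real.logb 2 c) * y) := by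
      refine hB t _ c x y ht (by exact_mod_cast hc1) hx1 hy1 (logb_iterLog_le a hn1) ?_
      have h2 : (S.card : ℝ) ≤ 4 * t * N := by exact_mod_cast hS
      have h3 : (G.wcol (4 * t) : ℝ) ≤ c := by exact_mod_cast hcw
      push_cast
      calc (2 : ℝ) * (S.card * G.wcol (4 * t)) ≤ 2 * ((4 * t * (2 * N₀)) * c) := by
            gcongr
            exact h2.trans (by gcongr)
        _ = 16 * t * N₀ * c := by ring
    have hlc : 0 ≤ Real.logb 2 (c : ℝ) := Real.logb_nonneg (by norm_num) (by exact_mod_cast hc1)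
    have h2 : (C'.card : ℝ) ≤ (G.wcol (4 * t) : ℝ) ^ 2 * (A * ((t : ℝ) ^ 2 * κ) ^ f) := by
      exact_mod_cast h1
    have hc1' : (1 : ℝ) ≤ c := by exact_mod_cast hc1
    have ht1' : (1 : ℝ) ≤ t := by exact_mod_cast ht
    calc (C'.card : ℝ) ≤ (G.wcol (4 * t) : ℝ) ^ 2 * (A * ((t : ℝ) ^ 2 * κ) ^ f) := h2
      _ ≤ (c : ℝ) ^ 2 * (A * ((t : ℝ) ^ 2 * (B * (t * (1 + Real.logb 2 c) * y))) ^ f) := by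
          have : (G.wcol (4 * t) : ℝ) ≤ c := by exact_mod_cast hcw
          gcongr
      _ = (A * B ^ f) * (t : ℝ) ^ (3 * f) * c ^ 2 * (1 + Real.logb 2 c) ^ f * y ^ f := by
          simp only [mul_pow, ← pow_mul]; ring
      _ ≤ (A * B ^ f) * (t : ℝ) ^ (3 * f) * c ^ 2 * (F * c) * y ^ f := by
          gcongr
          exact hF c hc1'
      _ = (A * (B ^ f * F)) * (t : ℝ) ^ (3 * f) * c ^ 3 * y ^ f := by ring
      _ ≤ K' * (t : ℝ) ^ (3 * f + m + 1) * c ^ 5 * y ^ f := by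
          have h3 : A * (B ^ f * F) ≤ (K' : ℝ) := by
            rw [hK']
            push_cast
            have := Nat.le_ceil (A * (B ^ f * F))
            have h4 : (0 : ℝ) ≤ K * 4 ^ m := by positivity
            linarith
          have h4 : (t : ℝ) ^ (3 * f) ≤ t ^ (3 * f + m + 1) := pow_le_pow_right₀ ht1' (by omega)
          have h5 : (c : ℝ) ^ 3 ≤ c ^ 5 := pow_le_pow_right₀ hc1' (by omega)
          gcongr
      _ = _ := by rw [hq]; push_cast; ring
  · have ht0 : (0 : ℝ) < t := by exact_mod_cast ht
    refine hcost.trans ((add_le_add (add_le_add hSC le_rfl) le_rfl).trans (le_of_eq ?_))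
    push_cast
    field_simp
    ring

lemma exists_hasPolylogOutliers {p : ℕ → ℕ} (hp : IsPolynomialFun p) (a : ℕ) :
    ∃ K m e : ℕ, 1 ≤ K ∧ HasPolylogOutliers.{u} p a K m e := by
  induction a with
  | zero => exact ⟨1, 0, 1, le_rfl, hasPolylogOutliers_zero p⟩
  | succ a ih =>
    obtain ⟨K, m, e, hK, h⟩ := ih
    exact h.succ hp hK

end Iteration

end SimpleGraph

theorem mainTheorem1 (p : ℕ → ℕ) (hp : IsPolynomialFun p) (a : ℕ) :
    ∃ q : ℕ → ℕ, IsPolynomialFun q ∧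
      ∀ (V : Type*) [Fintype V] [DecidableEq V] (G : SimpleGraph V),
        G.ExpansionBoundedBy p →
        ∀ ρ : V → ℝ, (∀ v, 0 ≤ ρ v) →
        ∀ t : ℕ, 1 ≤ t →
          ∃ C : Finset V, G.IsBalancedSeparator C ∧
            IsCheapWithOutliers ρ t
              ((q t : ℝ) * (G.wcol (q t) : ℝ) ^ 5 * iterLog a (Fintype.card V : ℝ)) C := by
  -- one more logarithm than required absorbs the power of the iterated logarithm
  obtain ⟨K, m, e, hK, h⟩ := SimpleGraph.exists_hasPolylogOutliers hp (a + 1)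
  obtain ⟨F, hF0, hF⟩ := exists_one_add_logb_pow_le e
  refine ⟨fun t => (K * (⌈F⌉₊ + 1)) * t ^ m, isPolynomialFun_const_mul_pow _ _, ?_⟩
  intro V _ _ G hG ρ hρ t ht
  rcases isEmpty_or_nonempty V with hV | hV
  · refine ⟨Finset.univ, G.isBalancedSeparator_univ,
      SimpleGraph.isCheapWithOutliers_univ_of_sum_eq_zero (by simp) t ?_⟩
    have := iterLog_nonneg a (Nat.cast_nonneg (α := ℝ) (Fintype.card V))
    positivity
  · obtain ⟨C, hC, hcheap⟩ := h V G hG ρ hρ t ht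
    refine ⟨C, hC, hcheap.mono ?_⟩
    have hn1 : (1 : ℝ) ≤ Fintype.card V := by exact_mod_cast Fintype.card_pos
    set x := iterLog a (Fintype.card V : ℝ)
    have hx1 : 1 ≤ x := one_le_iterLog a hn1
    have hlog : iterLog (a + 1) (Fintype.card V : ℝ) ^ e ≤ (⌈F⌉₊ + 1 : ℕ) * x := by
      have h0 := one_le_iterLog_succ a (Fintype.card V : ℝ)
      refine (pow_le_pow_left₀ (by linarith) (iterLog_succ_le a hn1) e).trans
        ((hF x hx1).trans ?_)
      gcongr
      push_cast
      exact (Nat.le_ceil F).trans (by linarith)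
    have hq : K * t ^ m ≤ K * (⌈F⌉₊ + 1) * t ^ m :=
      Nat.mul_le_mul_right _ (Nat.le_mul_of_pos_right _ (Nat.succ_pos _))
    have hw : (G.wcol (K * t ^ m) : ℝ) ≤ G.wcol (K * (⌈F⌉₊ + 1) * t ^ m) := by
      exact_mod_cast G.wcol_mono hq
    calc ((K * t ^ m : ℕ) : ℝ) * (G.wcol (K * t ^ m) : ℝ) ^ 5 *
          iterLog (a + 1) (Fintype.card V : ℝ) ^ e
        ≤ ((K * t ^ m : ℕ) : ℝ) * (G.wcol (K * (⌈F⌉₊ + 1) * t ^ m) : ℝ) ^ 5 *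
          ((⌈F⌉₊ + 1 : ℕ) * x) := by
            have h0 := one_le_iterLog_succ a (Fintype.card V : ℝ)
            gcongr
      _ = _ := by push_cast; ring
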